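/- **Setting.** Let $E$ be a finite dimensional CW complex with sets of $i$-cells $\mathcal E_i$ and cellular incidence numbers $d_{\alpha\beta}\in\mathbb Z$ ($\alpha\in\mathcal E_{i+1}$, $\beta\in\mathcal E_i$; the degree of the attaching map of $\alpha$ followed by the collapse of the complement of $\beta$ in the $i$-skeleton, for a choice of orientations of the cells). Assume that for every cell $\beta\in\mathcal E_i$ the set $\{\alpha\in\mathcal E_{i+1}\mid d_{\alpha\beta}\neq 0\}$ is finite. Let $G$ be a finite abelian group, $\hat G=\operatorname{Hom}(G,\mathbb Q/\mathbb Z)$, identified with the group of characters $G\to\mathbb C$, and $n\in\mathbb N$. Put $C_i=\bigoplus_{\mathcal E_i}\hat G$ and $C^i_{\mathrm{lf}}=\bigoplus_{\mathcal E_i}G$, with boundary $\partial:C_{i+1}\to C_i$, $\partial(\chi e_\alpha)=\sum_\beta d_{\alpha\beta}\chi e_\beta$, and coboundary $\partial^T:C^i_{\mathrm{lf}}\to C^{i+1}_{\mathrm{lf}}$, $\partial^T(g e_\beta)=\sum_\alpha d_{\alpha\beta}g e_\alpha$ (and $C_{-1}=C^{-1}_{\mathrm{lf}}=0$). Let $\mathfrak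 A$ be the quasi-local C*-algebra with one site for each $\sigma\in\mathcal E_n$ and one-site Hilbert space $\ell^2(G)$, i.e. the C*-inductive limit of the algebras $B(\bigotimes_{\sigma\in\Lambda}\ell^2(G))$, $\Lambda\subseteq\mathcal E_n$ finite. On $\ell^2(G)$ let $X^g|h\rangle=|g+h\rangle$ and $Z^\chi|h\rangle=\chi(h)|h\rangle$; for $a=\sum g_\sigma e_\sigma\in C^n_{\mathrm{lf}}$ and $b=\sum\chi_\sigma e_\sigma\in C_n$ let $X^a=\prod_\sigma (X^{g_\sigma})_\sigma$ and $Z^b=\prod_\sigma (Z^{\chi_\sigma})_\sigma$ in $\mathfrak A$. Let $\mathfrak A_{XZ}\subseteq\mathfrak A$ be the closed linear span of the operators $X^{\partial^Tc}Z^{\partial d}$ with $c\in C^{n-1}_{\mathrm{lf}}$, $d\in C_{n+1}$, let $\mathfrak A_{XZ}'$ be its commutant in $\mathfrak A$, let $J$ be the closed two-sided ideal of $\mathfrak A_{XZ}'$ generated by the elements $X^aZ^b-X^{a+\partial^Tc}Z^{b+\partial d}$ with $\partial^Ta=0$, $\partial b=0$, $c\in C^{n-1}_{\mathrm{lf}}$,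 $d\in C_{n+1}$, and let $\mathfrak A_{\mathrm{logical}}=\mathfrak A_{XZ}'/J$ with quotient map $p$. A *frustration-free ground state* is a state $\omega$ on $\mathfrak A$ with $\omega(X^{\partial^Tc}Z^{\partial d})=1$ for all $c\in C^{n-1}_{\mathrm{lf}}$, $d\in C_{n+1}$. The *corresponding logical state* is the state $\tilde\omega$ on $\mathfrak A_{\mathrm{logical}}$ with $\omega|_{\mathfrak A_{XZ}'}=\tilde\omega\circ p$. For a state $\varphi$ on a C*-algebra $\mathfrak B$ let $\pi_\varphi$ denote its GNS representation; $\varphi$ is a *factor state* if the von Neumann algebra $\pi_\varphi(\mathfrak B)''$ is a factor. Two states $\varphi_1,\varphi_2$ on $\mathfrak B$ are *quasi-equivalent* if there is a $*$-isomorphism $\tau:\pi_{\varphi_1}(\mathfrak B)''\to\pi_{\varphi_2}(\mathfrak B)''$ with $\tau(\pi_{\varphi_1}(B))=\pi_{\varphi_2}(B)$ for all $B\in\mathfrak B$. **Theorem.** Let $\omega$ be a frustration-free ground state and $\tilde\omega$ the corresponding logical state. 1. $\pi_\omega$ is irreducible if and only if $\pi_{\tilde\omega}$ is irreducible. 2.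 The centers $\pi_\omega(\mathfrak A)''\cap\pi_\omega(\mathfrak A)'$ and $\pi_{\tilde\omega}(\mathfrak A_{\mathrm{logical}})''\cap\pi_{\tilde\omega}(\mathfrak A_{\mathrm{logical}})'$ are $*$-isomorphic. In particular, $\omega$ is a factor state if and only if $\tilde\omega$ is a factor state. 3. If $\omega_1,\omega_2$ are frustration-free ground states which are factor states, with corresponding logical states $\tilde\omega_1,\tilde\omega_2$, then $\omega_1$ and $\omega_2$ are quasi-equivalent if and only if $\tilde\omega_1$ and $\tilde\omega_2$ are quasi-equivalent. -/

import Mathlib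

noncomputable section

open scoped ComplexOrder InnerProductSpace ENNReal
open Topology

namespace CellularKitaev

universe u v w w'

/-! ### Degrees and incidence numbers of a CW complex -/

section CW

/-- The `m`-sphere, as the boundary of the closed unit ball `D^(m+1)` on which Mathlib's
characteristic maps of `(m+1)`-cells are defined. -/
abbrev Sph (m : ℕ) : Type := Metric.sphere (0 : Fin (m + 1) → ℝ) 1

/-- The degree of a continuous self-map of the `m`-sphere, for `m ≥ 1`: the integer by which it acts
on `H_m(S^m; ℤ) ≅ ℤ`, written as the trace of the induced map on singular homology. -/
def degree {m : ℕ} (f : C(Sph m, Sph m)) : ℤ :=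
  LinearMap.trace ℤ
    (((AlgebraicTopology.singularHomologyFunctor (ModuleCat.{0} ℤ) m).obj
      (ModuleCat.of ℤ ℤ)).obj (TopCat.of (Sph m)))
    (((AlgebraicTopology.singularHomologyFunctor (ModuleCat.{0} ℤ) m).obj
      (ModuleCat.of ℤ ℤ)).map (TopCat.ofHom f)).hom

/-- Constant maps have degree zero. -/
theorem degree_const {m : ℕ} (hm : m ≠ 0) (p : Sph m) :
    degree (ContinuousMap.const (Sph m) p) = 0 := by
  let F := (AlgebraicTopology.singularHomologyFunctor (ModuleCat.{0} ℤ) m).obj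
    (ModuleCat.of ℤ ℤ)
  have hz : CategoryTheory.Limits.IsZero (F.obj (TopCat.of PUnit.{1})) :=
    AlgebraicTopology.isZero_singularHomologyFunctor_of_totallyDisconnectedSpace
      (ModuleCat.{0} ℤ) m (ModuleCat.of ℤ ℤ) (TopCat.of PUnit.{1}) hm
  have hfac : TopCat.ofHom (ContinuousMap.const (Sph m) p) =
      CategoryTheory.CategoryStruct.comp
        (TopCat.ofHom (ContinuousMap.const (Sph m) PUnit.unit))
        (TopCat.ofHom (ContinuousMap.const PUnit.{1} p)) := rfl
  have h0 : F.map (TopCat.ofHom (ContinuousMap.const (Sph m) p)) = 0 := by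
    rw [hfac, F.map_comp, hz.eq_zero_of_tgt (F.map (TopCat.ofHom
      (ContinuousMap.const (Sph m) PUnit.unit)))]
    simp
  change LinearMap.trace ℤ (F.obj (TopCat.of (Sph m)))
    (F.map (TopCat.ofHom (ContinuousMap.const (Sph m) p))).hom = 0
  rw [h0]
  simp

/-- The vector `(1 - 2‖x‖, (1 - ‖x‖) x)`, never zero; the boundary of the ball goes to
`(-1, 0)`. -/
def wrapVec {m : ℕ} (x : Fin m → ℝ) : Fin (m + 1) → ℝ :=
  Fin.cons (1 - 2 * ‖x‖) ((1 - ‖x‖) • x)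

theorem wrapVec_ne_zero {m : ℕ} (x : Fin m → ℝ) : wrapVec x ≠ 0 := by
  intro h
  have h1 : 1 - 2 * ‖x‖ = 0 := by simpa [wrapVec] using congrFun h 0
  have h2 : (1 - ‖x‖) • x = 0 := by
    ext i
    simpa [wrapVec] using congrFun h i.succ
  rcases smul_eq_zero.1 h2 with h3 | h3
  · linarith
  · rw [h3] at h1
    simp at h1

theorem continuous_wrapVec (m : ℕ) : Continuous (wrapVec : (Fin m → ℝ) → _) := by
  unfold wrapVec
  refine continuous_pi fun i => ?_
  refine Fin.cases ?_ (fun j => ?_) i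
  · simp only [Fin.cons_zero]; fun_prop
  · simp only [Fin.cons_succ]; fun_prop

/-- The quotient map `D^m → D^m / ∂D^m ≅ S^m`: the open ball is mapped homeomorphically onto the
complement of the point `(-1, 0)`, and the boundary of the ball to that point. -/
def wrap {m : ℕ} (x : Fin m → ℝ) : Sph m :=
  ⟨‖wrapVec x‖⁻¹ • wrapVec x, by
    rw [mem_sphere_zero_iff_norm, norm_smul, norm_inv, norm_norm,
      inv_mul_cancel₀ (norm_ne_zero_iff.2 (wrapVec_ne_zero x))]⟩

theorem continuous_wrap (m : ℕ) : Continuous (wrap : (Fin m → ℝ) → Sph m) := by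
  refine Continuous.subtype_mk ?_ _
  exact ((continuous_wrapVec m).norm.inv₀ fun x => norm_ne_zero_iff.2 (wrapVec_ne_zero x)).smul
    (continuous_wrapVec m)

/-- The base point `(-1, 0, …, 0)` of the `m`-sphere. -/
def basePt (m : ℕ) : Sph m :=
  ⟨-Pi.single 0 1, by simp [Pi.norm_single]⟩

theorem wrap_eq_basePt {m : ℕ} {x : Fin m → ℝ} (hx : ‖x‖ = 1) : wrap x = basePt m := by
  have h : wrapVec x = -Pi.single 0 1 := by
    ext i
    refine Fin.cases ?_ (fun j => ?_) i
    · simp [wrapVec, hx]; norm_num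
    · simp [wrapVec, hx]
  apply Subtype.ext
  simp [wrap, basePt, h, Pi.norm_single]

set_option linter.unusedSectionVars false

variable (E : Type u) [TopologicalSpace E] [T2Space E] [CWComplex (Set.univ : Set E)]

/-- The index set of the `i`-dimensional cells of `E`. -/
abbrev Cell (i : ℕ) : Type u := RelCWComplex.cell (Set.univ : Set E) i

variable {E}

/-- The map which collapses the complement of the open `m`-cell `β` to a point, followed by the
identification of the quotient with the `m`-sphere given by the characteristic map of `β`. -/
def pinch {m : ℕ} (β : Cell E m) (y : E) : Sph m :=
  open Classical in
  if y ∈ RelCWComplex.openCell m β then wrap ((RelCWComplex.map m β).symm y) else basePt m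

theorem pinch_of_notMem {m : ℕ} {β : Cell E m} {y : E} (h : y ∉ RelCWComplex.openCell m β) :
    pinch β y = basePt m := if_neg h

theorem pinch_map {m : ℕ} (β : Cell E m) {x : Fin m → ℝ}
    (hx : x ∈ Metric.closedBall (0 : Fin m → ℝ) 1) :
    pinch β (RelCWComplex.map m β x) = wrap x := by
  rcases lt_or_eq_of_le (mem_closedBall_zero_iff.1 hx) with h | h
  · have hb : x ∈ Metric.ball (0 : Fin m → ℝ) 1 := mem_ball_zero_iff.2 h
    have hm : RelCWComplex.map m β x ∈ RelCWComplex.openCell m β := ⟨x, hb, rfl⟩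
    rw [pinch, if_pos hm, (RelCWComplex.map m β).left_inv]
    rwa [RelCWComplex.source_eq]
  · have hf : RelCWComplex.map m β x ∈ RelCWComplex.cellFrontier m β :=
      ⟨x, mem_sphere_zero_iff_norm.2 h, rfl⟩
    rw [pinch_of_notMem, wrap_eq_basePt h]
    exact Set.disjoint_left.1 (RelCWComplex.disjoint_skeletonLT_openCell le_rfl)
      (RelCWComplex.cellFrontier_subset_skeletonLT m β hf)

/-- The collapsing map is continuous on the `m`-skeleton. -/
theorem isClosed_pinch_preimage {m : ℕ} (β : Cell E m) {K : Set (Sph m)} (hK : IsClosed K) :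
    IsClosed ((RelCWComplex.skeleton (Set.univ : Set E) m : Set E) ∩ pinch β ⁻¹' K) := by
  refine CWComplex.isClosed_of_disjoint_openCell_or_isClosed_inter_closedCell
    (C := (Set.univ : Set E)) (Set.subset_univ _) fun k _ j => ?_
  rcases lt_or_ge m k with hk | hk
  · left
    exact (RelCWComplex.disjoint_skeleton_openCell (by exact_mod_cast hk)).mono_left
      Set.inter_subset_left
  right
  have hsub : RelCWComplex.closedCell k j ⊆
      (RelCWComplex.skeleton (Set.univ : Set E) m : Set E) :=
    (RelCWComplex.closedCell_subset_skeleton k j).trans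
      (RelCWComplex.skeleton_mono (by exact_mod_cast hk))
  by_cases hkj : (⟨k, j⟩ : Σ n, Cell E n) = ⟨m, β⟩
  · cases hkj
    have : (RelCWComplex.skeleton (Set.univ : Set E) m : Set E) ∩ pinch β ⁻¹' K ∩
        RelCWComplex.closedCell m β =
        RelCWComplex.map m β '' (Metric.closedBall 0 1 ∩ wrap ⁻¹' K) := by
      ext y
      constructor
      · rintro ⟨⟨-, hy⟩, x, hx, rfl⟩
        refine ⟨x, ⟨hx, ?_⟩, rfl⟩
        rwa [Set.mem_preimage, pinch_map β hx] at hy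
      · rintro ⟨x, ⟨hx, hxK⟩, rfl⟩
        have hc : RelCWComplex.map m β x ∈ RelCWComplex.closedCell m β := ⟨x, hx, rfl⟩
        refine ⟨⟨hsub hc, ?_⟩, hc⟩
        rwa [Set.mem_preimage, pinch_map β hx]
    rw [this]
    refine IsCompact.isClosed (((isCompact_closedBall _ _).inter_right
      (hK.preimage (continuous_wrap m))).image_of_continuousOn ?_)
    exact (RelCWComplex.continuousOn m β).mono Set.inter_subset_left
  · have hdis : Disjoint (RelCWComplex.closedCell k j) (RelCWComplex.openCell m β) := by
      rw [← RelCWComplex.cellFrontier_union_openCell_eq_closedCell, Set.disjoint_union_left]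
      refine ⟨?_, RelCWComplex.disjoint_openCell_of_ne hkj⟩
      exact (RelCWComplex.disjoint_skeletonLT_openCell (by exact_mod_cast hk)).mono_left
        (RelCWComplex.cellFrontier_subset_skeletonLT k j)
    by_cases hb : basePt m ∈ K
    · have : (RelCWComplex.skeleton (Set.univ : Set E) m : Set E) ∩ pinch β ⁻¹' K ∩
          RelCWComplex.closedCell k j = RelCWComplex.closedCell k j := by
        refine Set.inter_eq_right.2 fun y hy => ⟨hsub hy, ?_⟩
        rwa [Set.mem_preimage, pinch_of_notMem (Set.disjoint_left.1 hdis hy)]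
      rw [this]
      exact RelCWComplex.isClosed_closedCell
    · have : (RelCWComplex.skeleton (Set.univ : Set E) m : Set E) ∩ pinch β ⁻¹' K ∩
          RelCWComplex.closedCell k j = ∅ := by
        refine Set.eq_empty_of_forall_notMem fun y hy => hb ?_
        have := hy.1.2
        rwa [Set.mem_preimage, pinch_of_notMem (Set.disjoint_left.1 hdis hy.2)] at this
      rw [this]
      exact isClosed_empty

/-- The map `S^m → E^m → S^m` attached to an `(m+1)`-cell `α` and an `m`-cell `β`: the attaching map
of `α`, followed by the collapse of the complement of `β` in the `m`-skeleton. -/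
def attachPinch {m : ℕ} (α : Cell E (m + 1)) (β : Cell E m) : C(Sph m, Sph m) where
  toFun x := pinch β (RelCWComplex.map (m + 1) α x)
  continuous_toFun := by
    rw [continuous_iff_isClosed]
    intro K hK
    have hc : Continuous fun x : Sph m => RelCWComplex.map (m + 1) α x :=
      ((RelCWComplex.continuousOn (m + 1) α).mono Metric.sphere_subset_closedBall).domRestrict
    convert (isClosed_pinch_preimage β hK).preimage hc using 1
    ext x
    simp only [Set.mem_preimage, Set.mem_inter_iff, iff_and_self]
    intro _
    exact RelCWComplex.cellFrontier_subset_skeleton m α ⟨x, x.2, rfl⟩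

/-- The incidence number `d_{αβ}` of an `(m+1)`-cell `α` and an `m`-cell `β`. For `m ≥ 1` it is the
degree of the map above. For `m = 0` the cell `α` is an oriented edge, and the number is
`1` for its final vertex, `-1` for its initial vertex, and `0` otherwise (also if these two agree).
The cells are oriented by their characteristic maps. -/
def incidence : {m : ℕ} → Cell E (m + 1) → Cell E m → ℤ
  | 0, α, β => open Classical in
      (if RelCWComplex.map 1 α (fun _ => 1) = RelCWComplex.map 0 β 0 then 1 else 0) -
        (if RelCWComplex.map 1 α (fun _ => -1) = RelCWComplex.map 0 β 0 then 1 else 0)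
  | _ + 1, α, β => degree (attachPinch α β)

theorem map_zero_injective {β β' : Cell E 0}
    (h : RelCWComplex.map 0 β 0 = RelCWComplex.map 0 β' 0) : β = β' := by
  apply RelCWComplex.injective_map_zero (Set.univ : Set E)
  simpa [Matrix.empty_eq] using h

/-- By closure-finiteness, a cell is incident to finitely many cells of one dimension less. -/
theorem finite_incidence_left {m : ℕ} (α : Cell E (m + 1)) :
    {β : Cell E m | incidence α β ≠ 0}.Finite := by
  rcases m with _ | m
  · have h (p : E) : {β : Cell E 0 | p = RelCWComplex.map 0 β 0}.Finite :=
      Set.Subsingleton.finite fun β hβ β' hβ' => map_zero_injective (hβ.symm.trans hβ')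
    refine ((h (RelCWComplex.map 1 α (fun _ => 1))).union
      (h (RelCWComplex.map 1 α (fun _ => -1)))).subset fun β hβ => ?_
    by_contra hn
    simp only [Set.mem_union, Set.mem_ofPred_eq, not_or] at hn
    exact hβ (by rw [incidence, if_neg hn.1, if_neg hn.2, sub_zero])
  · obtain ⟨I, hI⟩ := CWComplex.cellFrontier_subset_finite_openCell (m + 1 + 1) α
    refine (I (m + 1)).finite_toSet.subset fun β hβ => ?_
    by_contra hn
    refine hβ ?_
    have : attachPinch α β = ContinuousMap.const _ (basePt (m + 1)) := by
      ext1 x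
      refine pinch_of_notMem fun hx => ?_
      have hf := hI (show RelCWComplex.map (m + 1 + 1) α x ∈
        RelCWComplex.cellFrontier (m + 1 + 1) α from ⟨x, x.2, rfl⟩)
      simp only [Set.mem_iUnion] at hf
      obtain ⟨k, -, j, hj, hxj⟩ := hf
      by_cases hkj : (⟨k, j⟩ : Σ n, Cell E n) = ⟨m + 1, β⟩
      · cases hkj
        exact hn hj
      · exact Set.disjoint_left.1 (RelCWComplex.disjoint_openCell_of_ne hkj) hxj hx
    change degree (attachPinch α β) = 0
    rw [this, degree_const (Nat.succ_ne_zero m)]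

/-! ### Cellular chains and locally finite cochains -/

variable (E) in
/-- The standing assumption on the complex: every cell is incident to finitely many cells of one
dimension more. -/
class LocallyFiniteIncidence : Prop where
  finite_incidence_right : ∀ (m : ℕ) (β : Cell E m),
    {α : Cell E (m + 1) | incidence α β ≠ 0}.Finite

/-- The incidence numbers `(d_{αβ})_β` of an `(m+1)`-cell `α`. -/
def incidenceRow {m : ℕ} (α : Cell E (m + 1)) : Cell E m →₀ ℤ :=
  Finsupp.ofSupportFinite (fun β => incidence α β) (finite_incidence_left α)

/-- The incidence numbers `(d_{αβ})_α` of an `m`-cell `β`. -/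
def incidenceCol [LocallyFiniteIncidence E] {m : ℕ} (β : Cell E m) : Cell E (m + 1) →₀ ℤ :=
  Finsupp.ofSupportFinite (fun α => incidence α β)
    (LocallyFiniteIncidence.finite_incidence_right m β)

/-- The homomorphism `∑_i x_i e_i ↦ ∑_i ∑_j D_{ij} x_i e_j` given by an integer matrix `D` with
finite rows. -/
def matrixHom {I J : Type*} {M : Type*} [AddCommGroup M] (D : I → J →₀ ℤ) :
    (I →₀ M) →+ (J →₀ M) :=
  Finsupp.liftAddHom fun i =>
    { toFun := fun x => (D i).mapRange (fun d => d • x) (zero_smul ℤ x)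
      map_zero' := by ext j; simp
      map_add' := fun x y => by ext j; simp }

theorem matrixHom_apply {I J M : Type*} [AddCommGroup M] (D : I → J →₀ ℤ) (x : I →₀ M) (j : J) :
    matrixHom D x j = x.sum fun i m => D i j • m := by
  simp [matrixHom, Finsupp.sum_apply]

/-- The dual group `Ĝ = Hom(G, ℚ/ℤ)`, as the group of characters `G → ℂ`, written additively. -/
def Dual (G : Type v) [AddCommGroup G] : Type v := AddChar G ℂ

instance (G : Type v) [AddCommGroup G] : AddCommGroup (Dual G) :=
  inferInstanceAs (AddCommGroup (AddChar G ℂ))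

instance (G : Type v) [AddCommGroup G] : FunLike (Dual G) G ℂ :=
  inferInstanceAs (FunLike (AddChar G ℂ) G ℂ)

theorem Dual.add_apply {G : Type v} [AddCommGroup G] (χ χ' : Dual G) (g : G) :
    (χ + χ') g = χ g * χ' g := rfl

theorem Dual.zero_apply {G : Type v} [AddCommGroup G] (g : G) : (0 : Dual G) g = 1 := rfl

variable (E) (G : Type v) [AddCommGroup G]

/-- `C_i(E; Ĝ)`: finite cellular chains with coefficients in `Ĝ`. -/
abbrev Chain (i : ℕ) : Type (max u v) := Cell E i →₀ Dual G

/-- `C^i_lf(E; G)`: locally finite cochains, i.e. finite combinations of `i`-cells with coefficients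
in `G`. -/
abbrev LFCochain (i : ℕ) : Type (max u v) := Cell E i →₀ G

/-- The boundary map `∂ : C_{i+1}(E; Ĝ) → C_i(E; Ĝ)`. -/
def boundary (i : ℕ) : Chain E G (i + 1) →+ Chain E G i := matrixHom incidenceRow

/-- The group of boundaries in `C_n(E; Ĝ)`. -/
def boundaries (n : ℕ) : AddSubgroup (Chain E G n) := (boundary E G n).range

/-- The group of cycles in `C_n(E; Ĝ)`; every `0`-chain is a cycle. -/
def cycles : (n : ℕ) → AddSubgroup (Chain E G n)
  | 0 => ⊤
  | m + 1 => (boundary E G m).ker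

variable [LocallyFiniteIncidence E]

/-- The coboundary map `∂ᵀ : C^i_lf(E; G) → C^{i+1}_lf(E; G)`. -/
def coboundary (i : ℕ) : LFCochain E G i →+ LFCochain E G (i + 1) := matrixHom incidenceCol

/-- The group of cocycles in `C^n_lf(E; G)`. -/
def cocycles (n : ℕ) : AddSubgroup (LFCochain E G n) := (coboundary E G n).ker

/-- The group of coboundaries in `C^n_lf(E; G)`; there are no `(-1)`-cells. -/
def coboundaries : (n : ℕ) → AddSubgroup (LFCochain E G n)
  | 0 => ⊥
  | m + 1 => (coboundary E G m).range

end CW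

/-! ### The quasi-local algebra -/

section QuasiLocal

variable (S : Type u) (G : Type v)

/-- The Hilbert space with orthonormal basis `|h⟩` indexed by all configurations `h : S → G`. -/
abbrev ConfigSpace : Type (max u v) := lp (fun _ : S → G => ℂ) 2

variable {S G}

open Classical in
/-- The configuration which agrees with `k` on `Λ` and with `h` outside of `Λ`. -/
def splice (Λ : Finset S) (k : Λ → G) (h : S → G) : S → G :=
  fun s => if hs : s ∈ Λ then k ⟨s, hs⟩ else h s

/-- The restriction of a configuration to `Λ`. -/
def restr (Λ : Finset S) (h : S → G) : Λ → G := fun s => h s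

@[simp] theorem restr_splice (Λ : Finset S) (k : Λ → G) (h : S → G) :
    restr Λ (splice Λ k h) = k := by
  funext s; simp [restr, splice]

@[simp] theorem splice_splice (Λ : Finset S) (k l : Λ → G) (h : S → G) :
    splice Λ k (splice Λ l h) = splice Λ k h := by
  funext s; by_cases hs : s ∈ Λ <;> simp [splice, hs]

@[simp] theorem splice_restr (Λ : Finset S) (h : S → G) : splice Λ (restr Λ h) h = h := by
  funext s; by_cases hs : s ∈ Λ <;> simp [splice, restr, hs]

theorem splice_eq_iff {Λ : Finset S} {k : Λ → G} {h h' : S → G} :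
    splice Λ k h = h' ↔ k = restr Λ h' ∧ splice Λ (restr Λ h) h' = h := by
  constructor
  · rintro rfl; simp
  · rintro ⟨rfl, h2⟩; rw [← h2]; simp

variable [Fintype G]

open Classical in
/-- The function `A ψ` for an operator `A` on `⨂_{s ∈ Λ} ℓ²(G)` given by its matrix in the product
basis: `(A ⊗ 1) |h⟩ = ∑_j A(j, h|_Λ) |j on Λ, h off Λ⟩`, that is
`((A ⊗ 1) ψ)(h) = ∑_k A(h|_Λ, k) ψ(k on Λ, h off Λ)`. -/
def localFun (Λ : Finset S) (A : Matrix (Λ → G) (Λ → G) ℂ) (ψ : (S → G) → ℂ) (h : S → G) : ℂ :=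
  ∑ k : Λ → G, A (restr Λ h) k * ψ (splice Λ k h)

open Classical in
theorem exists_bound_localFun (Λ : Finset S) (A : Matrix (Λ → G) (Λ → G) ℂ) :
    ∃ C : ℝ, 0 ≤ C ∧ ∀ ψ : ConfigSpace S G, ∀ s : Finset (S → G),
      ∑ h ∈ s, ‖localFun Λ A ψ h‖ ^ (2 : ℝ≥0∞).toReal ≤ (C * ‖ψ‖) ^ (2 : ℝ≥0∞).toReal := by
  let N : ℝ := Fintype.card (Λ → G)
  let K : ℝ := ∑ j, ∑ k, ‖A j k‖
  have hK (j k) : ‖A j k‖ ≤ K :=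
    (Finset.single_le_sum (f := fun k => ‖A j k‖) (fun _ _ => norm_nonneg _)
      (Finset.mem_univ k)).trans
    (Finset.single_le_sum (f := fun j => ∑ k, ‖A j k‖)
      (fun _ _ => Finset.sum_nonneg fun _ _ => norm_nonneg _) (Finset.mem_univ j))
  have hK0 : 0 ≤ K := Finset.sum_nonneg fun _ _ => Finset.sum_nonneg fun _ _ => norm_nonneg _
  refine ⟨√(K ^ 2 * N ^ 3), Real.sqrt_nonneg _, fun ψ s => ?_⟩
  have h2 : (2 : ℝ≥0∞).toReal = ((2 : ℕ) : ℝ) := by norm_num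
  simp only [h2, Real.rpow_natCast]
  have hpt (h : S → G) : ‖localFun Λ A ψ h‖ ^ 2 ≤
      K ^ 2 * N * ∑ k : Λ → G, ‖ψ (splice Λ k h)‖ ^ 2 := by
    have h1 : ‖localFun Λ A ψ h‖ ≤ K * ∑ k : Λ → G, ‖ψ (splice Λ k h)‖ := by
      rw [Finset.mul_sum]
      refine (norm_sum_le _ _).trans (Finset.sum_le_sum fun k _ => ?_)
      rw [norm_mul]
      exact mul_le_mul_of_nonneg_right (hK _ _) (norm_nonneg _)
    calc ‖localFun Λ A ψ h‖ ^ 2 ≤ (K * ∑ k : Λ → G, ‖ψ (splice Λ k h)‖) ^ 2 := by gcongr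
      _ = K ^ 2 * (∑ k : Λ → G, ‖ψ (splice Λ k h)‖) ^ 2 := by ring
      _ ≤ K ^ 2 * (N * ∑ k : Λ → G, ‖ψ (splice Λ k h)‖ ^ 2) := by
          gcongr
          have := sq_sum_le_card_mul_sum_sq (s := (Finset.univ : Finset (Λ → G)))
            (f := fun k => ‖ψ (splice Λ k h)‖)
          simpa [N] using this
      _ = _ := by ring
  have hk (k : Λ → G) : ∑ h ∈ s, ‖ψ (splice Λ k h)‖ ^ 2 ≤ N * ‖ψ‖ ^ 2 := by
    have hfib : ∑ h ∈ s, ‖ψ (splice Λ k h)‖ ^ 2 =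
        ∑ j : Λ → G, ∑ h ∈ s with restr Λ h = j, ‖ψ (splice Λ k h)‖ ^ 2 :=
      (Finset.sum_fiberwise s (restr Λ) _).symm
    rw [hfib]
    have : ∀ j : Λ → G, ∑ h ∈ s with restr Λ h = j, ‖ψ (splice Λ k h)‖ ^ 2 ≤ ‖ψ‖ ^ 2 := by
      intro j
      have hinj : Set.InjOn (splice Λ k) ((s.filter fun h => restr Λ h = j : Finset _) :
          Set (S → G)) := by
        intro h hh h' hh' he
        have e1 : restr Λ h = j := (Finset.mem_filter.1 hh).2
        have e2 : restr Λ h' = j := (Finset.mem_filter.1 hh').2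
        have := congrArg (splice Λ j) he
        rw [splice_splice, splice_splice] at this
        rwa [← e1, splice_restr, e1, ← e2, splice_restr] at this
      rw [← Finset.sum_image (f := fun h => ‖ψ h‖ ^ 2) hinj]
      have := lp.sum_rpow_le_norm_rpow (p := 2) (by norm_num) ψ
        ((s.filter fun h => restr Λ h = j).image (splice Λ k))
      simpa only [h2, Real.rpow_natCast] using this
    calc _ ≤ ∑ _j : Λ → G, ‖ψ‖ ^ 2 := Finset.sum_le_sum fun j _ => this j
      _ = _ := by simp [N]
  calc ∑ h ∈ s, ‖localFun Λ A ψ h‖ ^ 2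
      ≤ ∑ h ∈ s, K ^ 2 * N * ∑ k : Λ → G, ‖ψ (splice Λ k h)‖ ^ 2 :=
        Finset.sum_le_sum fun h _ => hpt h
    _ = K ^ 2 * N * ∑ k : Λ → G, ∑ h ∈ s, ‖ψ (splice Λ k h)‖ ^ 2 := by
        rw [← Finset.mul_sum, Finset.sum_comm]
    _ ≤ K ^ 2 * N * ∑ _k : Λ → G, N * ‖ψ‖ ^ 2 := by
        gcongr with k
        exact hk k
    _ = (√(K ^ 2 * N ^ 3) * ‖ψ‖) ^ 2 := by
        rw [mul_pow, Real.sq_sqrt (by positivity)]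
        simp only [Finset.sum_const, Finset.card_univ, nsmul_eq_mul, N]; ring

/-- The bounded operator `A ⊗ 1` on configuration space, for an operator `A` on the finitely many
sites in `Λ`. -/
def localCLM (Λ : Finset S) (A : Matrix (Λ → G) (Λ → G) ℂ) :
    ConfigSpace S G →L[ℂ] ConfigSpace S G :=
  LinearMap.mkContinuousOfExistsBound
    { toFun := fun ψ => ⟨localFun Λ A ψ,
        memℓp_gen' ((exists_bound_localFun Λ A).choose_spec.2 ψ)⟩
      map_add' := fun ψ φ => by
        ext h
        change localFun Λ A (ψ + φ : ConfigSpace S G) h = localFun Λ A ψ h + localFun Λ A φ h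
        simp [localFun, mul_add, Finset.sum_add_distrib]
      map_smul' := fun c ψ => by
        ext h; simp [localFun, Finset.mul_sum, mul_left_comm] }
    (by
      obtain ⟨C, hC0, hC⟩ := exists_bound_localFun Λ A
      exact ⟨C, fun ψ => lp.norm_le_of_forall_sum_le (by norm_num)
        (mul_nonneg hC0 (norm_nonneg _)) (hC ψ)⟩)

@[simp] theorem localCLM_apply (Λ : Finset S) (A : Matrix (Λ → G) (Λ → G) ℂ)
    (ψ : ConfigSpace S G) (h : S → G) : localCLM Λ A ψ h = localFun Λ A ψ h := rfl

open Classical in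
theorem localFun_single (Λ : Finset S) (A : Matrix (Λ → G) (Λ → G) ℂ) (h h' : S → G) :
    localFun Λ A (lp.single (E := fun _ : S → G => ℂ) 2 h (1 : ℂ)) h' =
      if splice Λ (restr Λ h') h = h' then A (restr Λ h') (restr Λ h) else 0 := by
  unfold localFun
  have (k : Λ → G) : (lp.single (E := fun _ : S → G => ℂ) 2 h (1 : ℂ)) (splice Λ k h') =
      if k = restr Λ h then (if splice Λ (restr Λ h') h = h' then (1 : ℂ) else 0) else 0 := by
    rw [lp.single_apply, Pi.single_apply, ← ite_and]
    simp only [splice_eq_iff (h := h')]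
  simp_rw [this]
  simp

open Classical in
/-- The embedding `A ↦ A ⊗ 1` of the algebra of operators on the sites in `Λ`. -/
def localOp (Λ : Finset S) :
    Matrix (Λ → G) (Λ → G) ℂ →⋆ₐ[ℂ] (ConfigSpace S G →L[ℂ] ConfigSpace S G) where
  toFun := localCLM Λ
  map_one' := by
    ext ψ h
    simp [localFun, Matrix.one_apply]
  map_mul' A B := by
    ext ψ h
    simp only [localCLM_apply, localFun, mul_apply_eq_comp, restr_splice,
      splice_splice, Matrix.mul_apply, Finset.sum_mul, Finset.mul_sum]
    rw [Finset.sum_comm]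
    simp [mul_assoc]
  map_zero' := by
    ext ψ h
    simp [localFun]
  map_add' A B := by
    ext ψ h
    simp [localFun, add_mul, Finset.sum_add_distrib]
  commutes' c := by
    ext ψ h
    simp [localFun, Matrix.one_apply, Algebra.algebraMap_eq_smul_one]
  map_star' A := by
    refine lp.ext_continuousLinearMap (by norm_num) fun h => ?_
    ext h'
    simp only [ContinuousLinearMap.coe_comp, Function.comp_apply,
      lp.singleContinuousLinearMap_apply, localCLM_apply, localFun_single,
      ContinuousLinearMap.star_eq_adjoint]
    have e1 : (ContinuousLinearMap.adjoint (localCLM Λ A)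
        (lp.single (E := fun _ : S → G => ℂ) 2 h (1 : ℂ))) h' =
        ⟪lp.single (E := fun _ : S → G => ℂ) 2 h' (1 : ℂ), ContinuousLinearMap.adjoint (localCLM Λ A)
        (lp.single (E := fun _ : S → G => ℂ) 2 h (1 : ℂ))⟫_ℂ := by
      rw [lp.inner_single_left]; simp
    rw [e1, ContinuousLinearMap.adjoint_inner_right, lp.inner_single_right, localCLM_apply,
      localFun_single]
    have hc : splice Λ (restr Λ h) h' = h ↔ splice Λ (restr Λ h') h = h' := by
      rw [splice_eq_iff]; simp
    by_cases hh : splice Λ (restr Λ h') h = h'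
    · rw [if_pos hh, if_pos (hc.2 hh)]; simp [Matrix.star_apply]
    · rw [if_neg hh, if_neg (mt hc.1 hh)]; simp

/-- The embedding of a local algebra is injective. -/
theorem localOp_injective [Nonempty G] (Λ : Finset S) :
    Function.Injective (localOp (G := G) Λ) := by
  classical
  intro A B h
  ext j k
  obtain ⟨g⟩ := ‹Nonempty G›
  have := congrArg (fun T : ConfigSpace S G →L[ℂ] ConfigSpace S G =>
    T (lp.single (E := fun _ : S → G => ℂ) 2 (splice Λ k fun _ => g) (1 : ℂ))
      (splice Λ j fun _ => g)) h
  change localFun Λ A _ _ = localFun Λ B _ _ at this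
  simpa [localFun_single] using this

variable (S G)

/-- The quasi-local algebra: the norm closure of the `*`-algebra of all local observables. This is
the C*-inductive limit of the algebras of operators on `⨂_{s ∈ Λ} ℓ²(G)`, `Λ ⊆ S` finite, with the
inclusions `A ↦ A ⊗ 1`, realised on the Hilbert space spanned by all configurations, on which
each of these algebras acts faithfully. -/
def quasiLocalAlgebra : StarSubalgebra ℂ (ConfigSpace S G →L[ℂ] ConfigSpace S G) :=
  (StarAlgebra.adjoin ℂ (⋃ Λ : Finset S, Set.range (localOp (G := G) Λ))).topologicalClosure

variable {S G}

theorem localOp_mem (Λ : Finset S) (A : Matrix (Λ → G) (Λ → G) ℂ) :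
    localOp Λ A ∈ quasiLocalAlgebra S G :=
  StarSubalgebra.le_topologicalClosure _
    (StarAlgebra.subset_adjoin ℂ _ (Set.mem_iUnion.2 ⟨Λ, A, rfl⟩))

/-- The tensor product `⨂_{s ∈ Λ} M_s` of one-site operators, in the product basis. -/
def siteTensor (Λ : Finset S) (M : S → Matrix G G ℂ) : Matrix (Λ → G) (Λ → G) ℂ :=
  fun j k => ∏ s : Λ, M s (j s) (k s)

variable [AddCommGroup G]

open Classical in
/-- The generalised Pauli operator `X^g |h⟩ = |g + h⟩` on `ℓ²(G)`. -/
def siteX (g : G) : Matrix G G ℂ := fun j h => if j = g + h then 1 else 0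

open Classical in
/-- The generalised Pauli operator `Z^χ |h⟩ = χ(h) |h⟩` on `ℓ²(G)`. -/
def siteZ (χ : Dual G) : Matrix G G ℂ := Matrix.diagonal χ

/-- The observable `X^a = ∏_s (X^{a_s})_s` for a finitely supported `a`. -/
def pauliX (a : S →₀ G) : quasiLocalAlgebra S G :=
  ⟨localOp a.support (siteTensor a.support fun s => siteX (a s)), localOp_mem _ _⟩

/-- The observable `Z^b = ∏_s (Z^{b_s})_s` for a finitely supported `b`. -/
def pauliZ (b : S →₀ Dual G) : quasiLocalAlgebra S G :=
  ⟨localOp b.support (siteTensor b.support fun s => siteZ (b s)), localOp_mem _ _⟩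

end QuasiLocal

/-! ### States, GNS representations, quasi-equivalence -/

section States

/-- A state on a unital `*`-algebra over `ℂ`: a positive normalised linear functional. On a unital
C*-algebra such a functional is automatically continuous, of norm one. -/
structure State (A : Type*) [Ring A] [StarRing A] [Algebra ℂ A] extends A →ₗ[ℂ] ℂ where
  nonneg' : ∀ a : A, 0 ≤ toFun (star a * a)
  map_one' : toFun 1 = 1

instance (A : Type*) [Ring A] [StarRing A] [Algebra ℂ A] : CoeFun (State A) fun _ => A → ℂ :=
  ⟨fun ω => ω.toLinearMap⟩

variable {A : Type*} [Ring A] [StarRing A] [Algebra ℂ A]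

/-- A GNS triple `(H, π, Ω)` of a state: a Hilbert space, a `*`-representation on it by bounded
operators, and a cyclic vector which induces the state. It is unique up to unitary equivalence. -/
structure GNSTriple (ω : State A) where
  H : Type w
  [normedAddCommGroup : NormedAddCommGroup H]
  [innerProductSpace : InnerProductSpace ℂ H]
  [completeSpace : CompleteSpace H]
  π : A →⋆ₐ[ℂ] (H →L[ℂ] H)
  Ω : H
  cyclic : Dense (Set.range fun a : A => π a Ω)
  inner_eq : ∀ a : A, ω a = ⟪Ω, π a Ω⟫_ℂ

namespace GNSTriple

attribute [instance] normedAddCommGroup innerProductSpace completeSpace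

variable {ω ω₁ ω₂ : State A}

/-- The representation is irreducible: the space is nonzero, and its only closed invariant subspaces
are the trivial ones. -/
def IsIrreducible (R : GNSTriple.{w} ω) : Prop :=
  Nontrivial R.H ∧ ∀ K : Submodule ℂ R.H, IsClosed (K : Set R.H) →
    (∀ a : A, ∀ x ∈ K, R.π a x ∈ K) → K = ⊥ ∨ K = ⊤

/-- The commutant `π(A)'`. -/
def commutant (R : GNSTriple.{w} ω) : StarSubalgebra ℂ (R.H →L[ℂ] R.H) :=
  StarSubalgebra.centralizer ℂ (Set.range R.π)

/-- The von Neumann algebra `π(A)''` generated by the representation. -/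
def vonNeumann (R : GNSTriple.{w} ω) : StarSubalgebra ℂ (R.H →L[ℂ] R.H) :=
  StarSubalgebra.centralizer ℂ (R.commutant : Set (R.H →L[ℂ] R.H))

/-- The center `π(A)'' ∩ π(A)'` of this von Neumann algebra. -/
def center (R : GNSTriple.{w} ω) : StarSubalgebra ℂ (R.H →L[ℂ] R.H) :=
  R.vonNeumann ⊓ R.commutant

/-- `π(A)''` is a factor, i.e. its center consists of the multiples of the identity. -/
def IsFactor (R : GNSTriple.{w} ω) : Prop := R.center = ⊥

theorem π_mem_vonNeumann (R : GNSTriple.{w} ω) (a : A) : R.π a ∈ R.vonNeumann := by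
  rw [vonNeumann, StarSubalgebra.mem_centralizer_iff]
  intro g hg
  have h1 := (StarSubalgebra.mem_centralizer_iff ℂ).1 hg (R.π a) ⟨a, rfl⟩
  have h2 := (StarSubalgebra.mem_centralizer_iff ℂ).1 (star_mem hg) (R.π a) ⟨a, rfl⟩
  exact ⟨h1.1.symm, h2.1.symm⟩

end GNSTriple

/-- Two representations are quasi-equivalent: there is a `*`-isomorphism
`π₁(A)'' → π₂(A)''` of the generated von Neumann algebras which maps `π₁(a)` to `π₂(a)` for all
`a`. -/
def QuasiEquivalent {ω₁ ω₂ : State A} (R₁ : GNSTriple.{w} ω₁) (R₂ : GNSTriple.{w'} ω₂) : Prop :=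
  ∃ τ : R₁.vonNeumann ≃⋆ₐ[ℂ] R₂.vonNeumann,
    ∀ a : A, τ ⟨R₁.π a, R₁.π_mem_vonNeumann a⟩ = ⟨R₂.π a, R₂.π_mem_vonNeumann a⟩

end States

/-! ### The Kitaev model on the `n`-cells of `E`, and its logical algebra -/

section Model

variable (E : Type u) [TopologicalSpace E] [T2Space E] [CWComplex (Set.univ : Set E)]
  [LocallyFiniteIncidence E] (G : Type v) [AddCommGroup G] [Fintype G] (n : ℕ)

/-- The algebra of observables `𝔄`: the quasi-local algebra with one site for each `n`-cell. -/
abbrev Observables : Type (max u v) := quasiLocalAlgebra (Cell E n) G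

/-- The closed linear span `𝔄_XZ` of the operators `X^{∂ᵀc} Z^{∂d}`. -/
def stabilizerAlgebra : Submodule ℂ (Observables E G n) :=
  (Submodule.span ℂ {A | ∃ s ∈ coboundaries E G n, ∃ r ∈ boundaries E G n,
    A = pauliX s * pauliZ r}).topologicalClosure

/-- The commutant `𝔄_XZ'` of `𝔄_XZ` in `𝔄`. -/
def stabilizerCommutant : StarSubalgebra ℂ (Observables E G n) :=
  StarSubalgebra.centralizer ℂ (stabilizerAlgebra E G n : Set (Observables E G n))

/-- The elements `X^a Z^b - X^{a+∂ᵀc} Z^{b+∂d}` of `𝔄_XZ'`, with `∂ᵀa = 0` and `∂b = 0`. -/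
def logicalRelations : Set (stabilizerCommutant E G n) :=
  {A | ∃ a ∈ cocycles E G n, ∃ b ∈ cycles E G n,
    ∃ s ∈ coboundaries E G n, ∃ r ∈ boundaries E G n,
      (A : Observables E G n) = pauliX a * pauliZ b - pauliX (a + s) * pauliZ (b + r)}

/-- The closed two-sided ideal `J` of `𝔄_XZ'` generated by these elements. (Closed two-sided ideals
of a C*-algebra are self-adjoint.) -/
def logicalIdeal : Ideal (stabilizerCommutant E G n) :=
  sInf {I | IsClosed (I : Set (stabilizerCommutant E G n)) ∧ I.IsTwoSided ∧
    (∀ A ∈ I, star A ∈ I) ∧ logicalRelations E G n ⊆ I}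

instance : (logicalIdeal E G n).IsTwoSided where
  mul_mem_of_left b ha := by
    rw [logicalIdeal, Submodule.mem_sInf] at ha ⊢
    intro I hI
    have := hI.2.1
    exact Ideal.mul_mem_right b I (ha I hI)

theorem star_mem_logicalIdeal {A : stabilizerCommutant E G n} (hA : A ∈ logicalIdeal E G n) :
    star A ∈ logicalIdeal E G n := by
  rw [logicalIdeal, Submodule.mem_sInf] at hA ⊢
  exact fun I hI => hI.2.2.1 A (hA I hI)

/-- The algebra of logical observables `𝔄_logical = 𝔄_XZ' / J`. -/
abbrev Logical : Type (max u v) := stabilizerCommutant E G n ⧸ logicalIdeal E G n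

/-- The quotient map `p : 𝔄_XZ' → 𝔄_logical`. -/
abbrev toLogical : stabilizerCommutant E G n →ₐ[ℂ] Logical E G n :=
  Ideal.Quotient.mkₐ ℂ (logicalIdeal E G n)

/-- The involution of `𝔄_logical`, induced by the one of `𝔄_XZ'`. -/
instance : StarRing (Logical E G n) where
  star := Quotient.map star fun A B h => by
    replace h : A - B ∈ logicalIdeal E G n := (Submodule.quotientRel_def _).1 h
    refine (Submodule.quotientRel_def _).2 ?_
    have h' := star_mem_logicalIdeal E G n h
    rwa [star_sub] at h'
  star_involutive := by
    rintro ⟨A⟩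
    exact congrArg (toLogical E G n) (star_star A)
  star_mul := by
    rintro ⟨A⟩ ⟨B⟩
    exact congrArg (toLogical E G n) (star_mul A B)
  star_add := by
    rintro ⟨A⟩ ⟨B⟩
    exact congrArg (toLogical E G n) (star_add A B)

theorem toLogical_star (A : stabilizerCommutant E G n) :
    toLogical E G n (star A) = star (toLogical E G n A) := rfl

variable {E G n}

/-- A state on `𝔄` is a frustration-free ground state if its restriction to `𝔄_XZ` is the state
determined by `X^{∂ᵀc} Z^{∂d} ↦ 1`. -/
def IsFrustrationFree (ω : State (Observables E G n)) : Prop :=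
  ∀ s ∈ coboundaries E G n, ∀ r ∈ boundaries E G n, ω (pauliX s * pauliZ r) = 1

/-- `ω'` is the logical state corresponding to `ω`: the restriction of `ω` to `𝔄_XZ'` is
`ω' ∘ p`. -/
def IsLogicalState (ω : State (Observables E G n)) (ω' : State (Logical E G n)) : Prop :=
  ∀ A : stabilizerCommutant E G n, ω (A : Observables E G n) = ω' (toLogical E G n A)

end Model

end CellularKitaev

end

/-!
Call the operators `u = X^{∂ᵀc} Z^{∂d}` stabilizers. Frustration freeness says that the GNS vector
`Ω` of `ω` is fixed by all stabilizers. The argument is a comparison of the GNS space `H` of `ω`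
with its subspace `H₀` of stabilizer-fixed vectors, and it rests on one property of the Pauli
operators `X^a Z^b`: they are unitaries with dense span, and for two of them, `t` and `t'`, the
product `t* t'` either commutes with all stabilizers or satisfies `u t* t' = θ t* t' u` for some
stabilizer `u` and some scalar `θ ≠ 1` (`errorBasis_pauli`). In the second case the matrix elements
of `t* t'` between vectors of `H₀` vanish (`ErrorBasis.inner_twisted`). Such a family is called an
error basis below, and everything except its construction takes place in an arbitrary `*`-algebra.

*The corner.* Let `B` be the commutant of the stabilizers and `p` its quotient map. Since
`ω = ω̃ ∘ p` on `B`, the map `π_ω̃(p b) Ω̃ ↦ π_ω(b) Ω` extends to an isometry `V` which intertwines the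
actions of `B`, and the vanishing of matrix elements shows that its range is all of `H₀`
(`ErrorBasis.exists_corner`). So `P = V V*` is the projection onto `H₀`. It lies in `π_ω(𝔄)''`, and
`S ↦ V* S V` identifies `P π_ω(𝔄)'' P` with `π_ω̃(𝔄_logical)''`.

*Irreducibility and centers.* On commutants `S ↦ V* S V` is an isomorphism
`π_ω(𝔄)' ≃ π_ω̃(𝔄_logical)'` (`Corner.commutantEquiv`). Surjectivity amounts to extending an operator `S` of
the smaller commutant by `π_ω(a) V x ↦ π_ω(a) V S x`, which is well defined because `S` commutes
with all `V* π_ω(a) V`. The centre of a von Neumann algebra is the centre of its commutant, so the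
centres agree, and irreducibility is transported by mapping invariant subspaces back and forth along
`V`.

*Quasi-equivalence.* A `*`-isomorphism implementing `ω₁ ~ ω₂` maps `P₁` to `P₂`, because these are
the projections onto the fixed vectors of operators which correspond to each other; it therefore
restricts to the corners (`QuasiEquivalent.compress`). Conversely, the translates of the corner by
Pauli operators, one for each class of Paulis which differ by an element of `B` (a *syndrome*),
decompose `H` into an orthogonal sum of copies of the space of `ω̃`
(`Corner.isHilbertSum_translate`). An element of `π_ω₁(𝔄)''` is thus a matrix with entries in
`π_ω̃₁(𝔄_logical)''`, and a `*`-isomorphism `τ` of the logical von Neumann algebras can be applied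
to all entries. That the columns of the new matrix are again bounded, and that their inner products
are the images under `τ` of the old ones, follows because `τ` is automatically normal: it preserves
the order, hence suprema of the partial sums of `∑ a_σ* a_σ` (`IsStrongSum.map_eq`). From the
columns the isomorphism `π_ω₁(𝔄)'' ≃ π_ω₂(𝔄)''` is obtained by a GNS-type construction
(`ClosedUnderSqrt.exists_starAlgHom`, `exists_lift`, `QuasiEquivalent.of_compress`).
-/

noncomputable section

open scoped ComplexOrder InnerProductSpace ENNReal
open Topology

namespace CellularKitaev

open ContinuousLinearMap

set_option linter.unusedSectionVars false

universe u v w w' w₁ w₂ w₃ w₄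

/-! ### Representations of operator algebras, and columns of operators -/

section Operators

variable {H K : Type*} [NormedAddCommGroup H] [InnerProductSpace ℂ H] [CompleteSpace H]
  [NormedAddCommGroup K] [InnerProductSpace ℂ K] [CompleteSpace K]

theorem inner_self_eq_ofReal {H : Type*} [NormedAddCommGroup H] [InnerProductSpace ℂ H] (v : H) :
    ⟪v, v⟫_ℂ = ((‖v‖ ^ 2 : ℝ) : ℂ) := by
  rw [inner_self_eq_norm_sq_to_K]; push_cast; rfl

/-- Every positive operator in the `*`-algebra `M` is of the form `b* b` with `b ∈ M`. Among the
properties of von Neumann algebras, this is the only one which is needed to show that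
`*`-homomorphisms out of `M` are contractive and monotone. -/
def ClosedUnderSqrt (M : StarSubalgebra ℂ (H →L[ℂ] H)) : Prop :=
  ∀ a ∈ M, a.IsPositive → ∃ b ∈ M, star b * b = a

/-- The square root of a positive operator commutes with everything the operator commutes with. -/
theorem closedUnderSqrt_centralizer (S : Set (H →L[ℂ] H)) :
    ClosedUnderSqrt (StarSubalgebra.centralizer ℂ S) := by
  intro a ha hpos
  have h0 : 0 ≤ a := (ContinuousLinearMap.nonneg_iff_isPositive a).2 hpos
  have hs : IsSelfAdjoint (CFC.sqrt a) := IsSelfAdjoint.of_nonneg (CFC.sqrt_nonneg a)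
  refine ⟨CFC.sqrt a, ?_, ?_⟩
  · rw [StarSubalgebra.mem_centralizer_iff] at ha ⊢
    intro g hg
    have key : ∀ g, g * a = a * g → g * CFC.sqrt a = CFC.sqrt a * g := by
      intro g hg
      have h1 : Commute a g := hg.symm
      rw [CFC.sqrt_eq_cfc]
      exact (h1.cfc_nnreal _).symm
    exact ⟨key g (ha g hg).1, key _ (ha g hg).2⟩
  · rw [hs.star_eq, CFC.sqrt_mul_sqrt_self a h0]

/-- The positive operator `‖x‖² - x* x` has a square root in the algebra. In this form the operator
norm of `x` enters the algebra by an identity, which `*`-homomorphisms preserve. -/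
theorem ClosedUnderSqrt.exists_star_mul_self_add {M : StarSubalgebra ℂ (H →L[ℂ] H)}
    (hM : ClosedUnderSqrt M) {x : H →L[ℂ] H} (hx : x ∈ M) :
    ∃ z ∈ M, star x * x + star z * z = ((‖x‖ ^ 2 : ℝ) : ℂ) • 1 := by
  have hmem : ((‖x‖ ^ 2 : ℝ) : ℂ) • 1 - star x * x ∈ M :=
    sub_mem (SMulMemClass.smul_mem _ (one_mem _)) (mul_mem (star_mem hx) hx)
  obtain ⟨z, hz, hzz⟩ := hM _ hmem (by
    rw [ContinuousLinearMap.isPositive_def]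
    refine ⟨?_, fun v => ?_⟩
    · rw [← ContinuousLinearMap.isSelfAdjoint_iff_isSymmetric]
      refine IsSelfAdjoint.sub ?_ (IsSelfAdjoint.star_mul_self x)
      rw [isSelfAdjoint_iff, star_smul, star_one]
      simp
    · rw [ContinuousLinearMap.reApplyInnerSelf_apply]
      simp only [sub_apply, smul_apply, one_apply_eq_self, mul_apply_eq_comp, inner_sub_left,
        star_eq_adjoint, adjoint_inner_left, inner_smul_left, map_sub]
      rw [inner_self_eq_ofReal, inner_self_eq_ofReal]
      have : ‖x v‖ ^ 2 ≤ (‖x‖ * ‖v‖) ^ 2 := by gcongr; exact x.le_opNorm v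
      rw [Complex.conj_ofReal]
      rw [← Complex.ofReal_mul, RCLike.re_eq_complex_re, Complex.ofReal_re, Complex.ofReal_re,
        sub_nonneg]
      rwa [mul_pow] at this)
  exact ⟨z, hz, by rw [hzz]; abel⟩

/-- A GNS-type construction: a family of vectors `ρ x j`, linear in `x ∈ N`, whose inner products
satisfy `⟪ρ x j, ρ y k⟫ = ⟪ρ 1 j, ρ (x* y) k⟫`, comes from a representation `Ψ` of `N` for which
`Ψ x (ρ y j) = ρ (x y) j`, provided that the vectors `ρ 1 j` are total. -/
theorem ClosedUnderSqrt.exists_starAlgHom {N : StarSubalgebra ℂ (K →L[ℂ] K)}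
    (hN : ClosedUnderSqrt N) {J : Type*}
    (ρ : N →ₗ[ℂ] J → H)
    (hρ : ∀ x y j k, ⟪ρ x j, ρ y k⟫_ℂ = ⟪ρ 1 j, ρ (star x * y) k⟫_ℂ)
    (htot : Dense (Submodule.span ℂ (Set.range (ρ 1)) : Set H)) :
    ∃ Ψ : N →⋆ₐ[ℂ] (H →L[ℂ] H), ∀ x y j, Ψ x (ρ y j) = ρ (x * y) j := by
  let w : N → (J →₀ ℂ) →ₗ[ℂ] H := fun x =>
    Finsupp.linearCombination ℂ (ρ x)
  have hw : ∀ x y s t, ⟪w x s, w y t⟫_ℂ = ⟪w 1 s, w (star x * y) t⟫_ℂ := by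
    intro x y s t
    simp only [w, Finsupp.linearCombination_apply, Finsupp.sum, sum_inner, inner_sum,
      inner_smul_left, inner_smul_right, hρ x y]
  have hwadd : ∀ x y s, w (x + y) s = w x s + w y s := by
    intro x y s
    simp [w, Finsupp.linearCombination_apply, Finsupp.sum, Finset.sum_add_distrib]
  have hwsmul : ∀ (c : ℂ) x s, w (c • x) s = c • w x s := by
    intro c x s
    simp [w, Finsupp.linearCombination_apply, Finsupp.sum, Finset.smul_sum, smul_comm c]
  have hdense : DenseRange (w 1) := by
    rw [DenseRange, ← LinearMap.coe_range, Finsupp.range_linearCombination]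
    exact htot
  have hbound : ∀ x : N, ∃ C, ∀ s, ‖w x s‖ ≤ C * ‖w 1 s‖ := by
    intro x
    obtain ⟨z, hz, hxz⟩ := hN.exists_star_mul_self_add x.2
    -- `‖w x s‖² + ‖w z s‖² = ‖x‖² ‖w 1 s‖²`, since `x* x + z* z = ‖x‖²`.
    refine ⟨‖(x : K →L[ℂ] K)‖, fun s => ?_⟩
    have h1 : star x * x + star ⟨z, hz⟩ * ⟨z, hz⟩ =
        ((‖(x : K →L[ℂ] K)‖ ^ 2 : ℝ) : ℂ) • (1 : N) :=
      Subtype.ext hxz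
    have h2 := hw x x s s
    have h3 := hw ⟨z, hz⟩ ⟨z, hz⟩ s s
    have h4 : ⟪w x s, w x s⟫_ℂ + ⟪w ⟨z, hz⟩ s, w ⟨z, hz⟩ s⟫_ℂ =
        ((‖(x : K →L[ℂ] K)‖ ^ 2 : ℝ) : ℂ) * ⟪w 1 s, w 1 s⟫_ℂ := by
      rw [h2, h3, ← inner_add_right, ← hwadd, h1, hwsmul, inner_smul_right]
    simp only [inner_self_eq_ofReal] at h4
    norm_cast at h4
    refine (sq_le_sq₀ (norm_nonneg _) (by positivity)).1 ?_
    rw [mul_pow, ← h4]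
    exact le_add_of_nonneg_right (by positivity)
  let E : N → (H →L[ℂ] H) := fun x => (w x).extendOfNorm (w 1)
  have hE1 : ∀ x s, E x (w 1 s) = w x s := fun x s =>
    LinearMap.extendOfNorm_eq hdense (hbound x) s
  have hext : ∀ T T' : H →L[ℂ] H, (∀ s, T (w 1 s) = T' (w 1 s)) → T = T' := by
    intro T T' h
    refine ContinuousLinearMap.coeFn_injective ?_
    exact hdense.equalizer T.continuous T'.continuous (funext h)
  have hvec : ∀ u u' : H, (∀ s, ⟪w 1 s, u⟫_ℂ = ⟪w 1 s, u'⟫_ℂ) → u = u' := by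
    intro u u' h
    refine ext_inner_left ℂ fun v => ?_
    have h1 : Continuous fun v => ⟪v, u⟫_ℂ := by fun_prop
    have h2 : Continuous fun v => ⟪v, u'⟫_ℂ := by fun_prop
    exact congrFun (hdense.equalizer h1 h2 (funext h)) v
  have hstar : ∀ x, E (star x) = star (E x) := by
    intro x
    refine hext _ _ fun s => hvec _ _ fun t => ?_
    rw [hE1, star_eq_adjoint, adjoint_inner_right, hE1, hw x 1, mul_one]
  have hE : ∀ x y s, E x (w y s) = w (x * y) s := by
    intro x y s
    refine hvec _ _ fun t => ?_
    rw [← adjoint_inner_left, ← star_eq_adjoint, ← hstar, hE1, hw, star_star]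
  refine ⟨⟨⟨⟨⟨⟨E, ?_⟩, ?_⟩, ?_, ?_⟩, ?_⟩, hstar⟩, fun x y j => ?_⟩
  · exact hext _ _ fun s => by rw [hE1]; rfl
  · exact fun x y => hext _ _ fun s => by rw [hE1, mul_apply_eq_comp, hE1, hE]
  · refine hext _ _ fun s => ?_
    change E 0 _ = _
    rw [hE1]; simpa using hwsmul 0 0 s
  · exact fun x y => hext _ _ fun s => by
      change E _ _ = (E _ + E _) _
      rw [hE1, add_apply, hE1, hE1, hwadd]
  · refine fun c => hext _ _ fun s => ?_
    change E _ _ = _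
    rw [hE1, Algebra.algebraMap_eq_smul_one, hwsmul, Algebra.algebraMap_eq_smul_one]; rfl
  · have := hE x y (Finsupp.single j 1)
    simpa [w] using this

variable {ι : Type*} {W : ι → K →ₗᵢ[ℂ] H}

theorem inner_hilbertSum_eq (hW : IsHilbertSum ℂ (fun _ : ι => K) W) (i : ι) (ζ : K) (v : H) :
    ⟪W i ζ, v⟫_ℂ = ⟪ζ, hW.linearIsometryEquiv v i⟫_ℂ := by
  classical
  rw [← hW.linearIsometryEquiv_symm_apply_single ζ, ← hW.linearIsometryEquiv.inner_map_map,
    LinearIsometryEquiv.apply_symm_apply, lp.inner_single_left]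

theorem hasSum_normSq_of_hilbertSum (hW : IsHilbertSum ℂ (fun _ : ι => K) W) {e : ι → K} {v : H}
    (he : ∀ i ζ, ⟪W i ζ, v⟫_ℂ = ⟪ζ, e i⟫_ℂ) : HasSum (fun i => ‖e i‖ ^ 2) (‖v‖ ^ 2) := by
  have h1 : ∀ i, hW.linearIsometryEquiv v i = e i := fun i =>
    ext_inner_left ℂ fun ζ => by rw [← he, inner_hilbertSum_eq hW]
  have h2 := lp.hasSum_inner (𝕜 := ℂ) (hW.linearIsometryEquiv v) (hW.linearIsometryEquiv v)
  simp only [h1, LinearIsometryEquiv.inner_map_map, inner_self_eq_ofReal] at h2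
  exact Complex.hasSum_ofReal.1 h2

/-- Operators `e i : F → K` whose squared norms have bounded sums are the components of an operator
from `F` into the Hilbert sum of the copies `W i` of `K`. -/
theorem exists_column (hW : IsHilbertSum ℂ (fun _ : ι => K) W) {F : Type*}
    [NormedAddCommGroup F] [InnerProductSpace ℂ F] (e : ι → F →L[ℂ] K) (C : ℝ) (hC : 0 ≤ C)
    (he : ∀ (s : Finset ι) ξ, ∑ i ∈ s, ‖e i ξ‖ ^ 2 ≤ (C * ‖ξ‖) ^ 2) :
    ∃ d : F →L[ℂ] H, ∀ i ζ ξ, ⟪W i ζ, d ξ⟫_ℂ = ⟪ζ, e i ξ⟫_ℂ := by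
  have h2 : (2 : ℝ≥0∞).toReal = ((2 : ℕ) : ℝ) := by norm_num
  have he' : ∀ ξ (s : Finset ι), ∑ i ∈ s, ‖e i ξ‖ ^ (2 : ℝ≥0∞).toReal ≤
      (C * ‖ξ‖) ^ (2 : ℝ≥0∞).toReal := by
    intro ξ s
    simpa only [h2, Real.rpow_natCast] using he s ξ
  let f : F →ₗ[ℂ] lp (fun _ : ι => K) 2 :=
    { toFun := fun ξ => ⟨fun i => e i ξ, memℓp_gen' (he' ξ)⟩
      map_add' := fun ξ η => Subtype.ext (funext fun i => map_add (e i) ξ η)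
      map_smul' := fun c ξ => Subtype.ext (funext fun i => map_smul (e i) c ξ) }
  let g : F →L[ℂ] lp (fun _ : ι => K) 2 := f.mkContinuous C fun ξ =>
    lp.norm_le_of_forall_sum_le (by norm_num) (mul_nonneg hC (norm_nonneg _)) (he' ξ)
  refine ⟨(hW.linearIsometryEquiv.symm.toContinuousLinearEquiv : _ →L[ℂ] H) ∘L g,
    fun i ζ ξ => ?_⟩
  rw [inner_hilbertSum_eq hW]
  simp [g, f]

end Operators

/-! ### Fixed vectors of the stabilizers -/

section Corner

variable {A L : Type*} [Ring A] [StarRing A] [Algebra ℂ A]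
  [Ring L] [StarRing L] [Algebra ℂ L]

namespace GNSTriple

variable {ω : State A} (R : GNSTriple.{w} ω)

theorem inner_π (a : A) (x y : R.H) : ⟪x, R.π a y⟫_ℂ = ⟪R.π (star a) x, y⟫_ℂ := by
  rw [map_star, star_eq_adjoint, adjoint_inner_left]

theorem π_mul (a b : A) (x : R.H) : R.π (a * b) x = R.π a (R.π b x) := by
  rw [map_mul, mul_apply_eq_comp]

theorem mem_commutant {T : R.H →L[ℂ] R.H} :
    T ∈ R.commutant ↔ ∀ a x, T (R.π a x) = R.π a (T x) := by
  rw [commutant, StarSubalgebra.mem_centralizer_iff]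
  constructor
  · intro h a x
    exact (congrArg (fun S => S x) (h _ ⟨a, rfl⟩).1).symm
  · rintro h _ ⟨a, rfl⟩
    refine ⟨?_, ?_⟩
    · ext x; exact (h a x).symm
    · rw [← map_star]; ext x; exact (h _ x).symm

theorem mem_vonNeumann {m : R.H →L[ℂ] R.H} :
    m ∈ R.vonNeumann ↔ ∀ T ∈ R.commutant, ∀ x, m (T x) = T (m x) := by
  rw [vonNeumann, StarSubalgebra.mem_centralizer_iff]
  constructor
  · intro h T hT x
    exact (congrArg (fun S => S x) (h T hT).1).symm
  · intro h T hT
    refine ⟨?_, ?_⟩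
    · ext x; exact (h T hT x).symm
    · ext x; exact (h _ (star_mem hT) x).symm

theorem closedUnderSqrt_commutant : ClosedUnderSqrt R.commutant := closedUnderSqrt_centralizer _

theorem closedUnderSqrt_vonNeumann : ClosedUnderSqrt R.vonNeumann := closedUnderSqrt_centralizer _

theorem eq_zero_of_forall_inner {y : R.H} (h : ∀ a, ⟪R.π a R.Ω, y⟫_ℂ = 0) : y = 0 := by
  have h1 : Continuous fun v => ⟪v, y⟫_ℂ := by fun_prop
  have h2 : (fun v => ⟪v, y⟫_ℂ) = fun _ => 0 := by
    refine Continuous.ext_on R.cyclic h1 continuous_const ?_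
    rintro _ ⟨a, rfl⟩
    exact h a
  exact inner_self_eq_zero.1 (congrFun h2 y)

theorem norm_Ω : ‖R.Ω‖ = 1 := by
  have h := R.inner_eq 1
  rw [map_one R.π, one_apply_eq_self, inner_self_eq_ofReal, show ω 1 = 1 from ω.map_one'] at h
  have h' : ‖R.Ω‖ ^ 2 = 1 := by exact_mod_cast h.symm
  exact (pow_eq_one_iff_of_nonneg (norm_nonneg _) two_ne_zero).1 h'

theorem Ω_ne_zero : R.Ω ≠ 0 := by
  intro h
  have := R.norm_Ω
  simp [h] at this

/-- An isometry with expectation `1` fixes the GNS vector: this is the equality case of the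
Cauchy–Schwarz inequality. -/
theorem π_Ω_eq {u : A} (hu : star u * u = 1) (h : ω u = 1) : R.π u R.Ω = R.Ω := by
  have h1 : ‖R.π u R.Ω‖ = 1 := by
    have h2 : ⟪R.π u R.Ω, R.π u R.Ω⟫_ℂ = 1 := by
      rw [inner_π, ← π_mul, hu, map_one, one_apply_eq_self, inner_self_eq_ofReal, R.norm_Ω]
      simp
    rw [inner_self_eq_ofReal] at h2
    have h' : ‖R.π u R.Ω‖ ^ 2 = 1 := by exact_mod_cast h2
    exact (pow_eq_one_iff_of_nonneg (norm_nonneg _) two_ne_zero).1 h'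
  exact ((inner_eq_one_iff_of_norm_eq_one (𝕜 := ℂ) R.norm_Ω h1).1
    (by rw [← R.inner_eq, h])).symm

end GNSTriple

variable [StarModule ℂ A]

/-- An error basis `T` of a `*`-algebra `A`, relative to a set `U` of isometries (the stabilizers)
and a `*`-subalgebra `B` commuting with `U`: a family of unitaries with dense span which contains
`1`, such that each product `T i* T j` either lies in `B` or picks up a scalar `θ ≠ 1` when it is
commuted with some stabilizer. For the Pauli operators, `B` is the whole commutant of `U`. -/
structure ErrorBasis [TopologicalSpace A] {ι : Type*} (B : StarSubalgebra ℂ A) (U : Set A)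
    (T : ι → A) : Prop where
  star_mul_stabilizer : ∀ u ∈ U, star u * u = 1
  star_mul_self : ∀ i, star (T i) * T i = 1
  mul_star_self : ∀ i, T i * star (T i) = 1
  exists_eq_one : ∃ i, T i = 1
  dense_span : Dense (Submodule.span ℂ (Set.range T) : Set A)
  commute : ∀ b ∈ B, ∀ u ∈ U, u * b = b * u
  mem_or_twisted : ∀ i j, star (T i) * T j ∈ B ∨ ∃ u ∈ U, ∃ θ : ℂ, θ ≠ 1 ∧
    u * (star (T i) * T j) = θ • (star (T i) * T j * u)

variable {ω : State A} {ω' : State L} {B : StarSubalgebra ℂ A}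

/-- The identification of a representation `R'` of `L` with a corner of a representation `R` of `A`:
an isometry `V` onto the subspace of vectors fixed by all `u ∈ U`, which maps the cyclic vector of
`R'` to that of `R` and intertwines the actions of `B` through `p : B → L`. The last field says that
the projection `V V*` acts as the identity on the fixed vectors, i.e. that the range is not
smaller. -/
structure Corner (R : GNSTriple.{w} ω) (R' : GNSTriple.{w'} ω') (p : B →ₐ[ℂ] L) (U : Set A) where
  V : R'.H →L[ℂ] R.H
  inner_map : ∀ x y, ⟪V x, V y⟫_ℂ = ⟪x, y⟫_ℂ
  map_π : ∀ b x, V (R'.π (p b) x) = R.π b (V x)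
  map_Ω : V R'.Ω = R.Ω
  fixed_V : ∀ u ∈ U, ∀ x, R.π u (V x) = V x
  V_adjoint_of_fixed : ∀ x, (∀ u ∈ U, R.π u x = x) → V (adjoint V x) = x

namespace ErrorBasis

variable [TopologicalSpace A] {ι : Type*} {U : Set A} {T : ι → A}

/-- A continuous linear map on `A` is determined by its values on an error basis. -/
theorem eq_zero_of_continuous (hT : ErrorBasis B U T) {M : Type*} [AddCommGroup M] [Module ℂ M]
    [TopologicalSpace M] [T2Space M] (f : A →ₗ[ℂ] M) (hf : Continuous f) (h : ∀ i, f (T i) = 0)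
    (a : A) : f a = 0 := by
  have h2 : (f : A → M) = fun _ => 0 := by
    refine Continuous.ext_on hT.dense_span hf continuous_const fun x hx => ?_
    have : Submodule.span ℂ (Set.range T) ≤ LinearMap.ker f := by
      rw [Submodule.span_le]
      rintro _ ⟨i, rfl⟩
      exact h i
    exact this hx
  exact congrFun h2 a

/-- The dichotomy for single elements of the error basis, one of which is `1`. -/
theorem mem_or_twisted' (hT : ErrorBasis B U T) (j : ι) : T j ∈ B ∨ ∃ u ∈ U, ∃ θ : ℂ, θ ≠ 1 ∧
    u * T j = θ • (T j * u) := by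
  obtain ⟨i, hi⟩ := hT.exists_eq_one
  have := hT.mem_or_twisted i j
  rwa [hi, star_one, one_mul] at this

/-- An operator which commutes with `u` up to a scalar `θ ≠ 1` has no matrix elements between
vectors fixed by `u`. -/
theorem inner_twisted {R : GNSTriple.{w} ω} {u t : A} (hu : star u * u = 1) {θ : ℂ} (hθ : θ ≠ 1)
    (h : u * t = θ • (t * u)) {x y : R.H} (hx : R.π u x = x) (hy : R.π u y = y) :
    ⟪x, R.π t y⟫_ℂ = 0 := by
  have h1 : R.π (star u) x = x := by
    conv_lhs => rw [← hx]
    rw [← R.π_mul, hu, map_one, one_apply_eq_self]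
  have h2 : ⟪x, R.π t y⟫_ℂ = θ * ⟪x, R.π t y⟫_ℂ := by
    conv_lhs => rw [← h1, ← R.inner_π, ← R.π_mul, h, map_smul, smul_apply, inner_smul_right,
      R.π_mul, hy]
  have h3 : (1 - θ) * ⟪x, R.π t y⟫_ℂ = 0 := by linear_combination h2
  exact (mul_eq_zero.1 h3).resolve_left (sub_ne_zero.2 hθ.symm)

/-- If `ω` takes the value `1` on the stabilizers and restricts to `ω' ∘ p` on `B`, then the GNS
representation of `ω'` is a corner of the one of `ω`. -/
theorem exists_corner (hT : ErrorBasis B U T) (R : GNSTriple.{w} ω) (R' : GNSTriple.{w'} ω')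
    (hR : Continuous R.π) (p : B →ₐ[ℂ] L) (hp : Function.Surjective p)
    (hps : ∀ b, p (star b) = star (p b)) (hω : ∀ u ∈ U, ω u = 1)
    (hωp : ∀ b : B, ω (b : A) = ω' (p b)) : Nonempty (Corner R R' p U) := by
  have hUB : ∀ u ∈ U, R.π u R.Ω = R.Ω := fun u hu =>
    R.π_Ω_eq (hT.star_mul_stabilizer u hu) (hω u hu)
  let f : B →ₗ[ℂ] R'.H :=
    { toFun := fun b => R'.π (p b) R'.Ω
      map_add' := by simp
      map_smul' := by simp }
  let g : B →ₗ[ℂ] R.H :=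
    { toFun := fun b => R.π b R.Ω
      map_add' := by simp
      map_smul' := by simp }
  have hfg : ∀ b c, ⟪g b, g c⟫_ℂ = ⟪f b, f c⟫_ℂ := by
    intro b c
    change ⟪R.π b R.Ω, R.π c R.Ω⟫_ℂ = ⟪R'.π (p b) R'.Ω, R'.π (p c) R'.Ω⟫_ℂ
    have h1 := R.inner_π (star (b : A)) R.Ω (R.π c R.Ω)
    have h2 := R'.inner_π (star (p b)) R'.Ω (R'.π (p c) R'.Ω)
    rw [star_star] at h1 h2
    rw [← h1, ← h2, ← R.π_mul, ← R'.π_mul, ← R.inner_eq, ← R'.inner_eq, ← hps, ← map_mul, ← hωp]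
    rfl
  have hnorm : ∀ b, ‖g b‖ = ‖f b‖ := by
    intro b
    have := hfg b b
    rw [inner_self_eq_ofReal, inner_self_eq_ofReal] at this
    have h' : ‖g b‖ ^ 2 = ‖f b‖ ^ 2 := by exact_mod_cast this
    exact (sq_eq_sq₀ (norm_nonneg _) (norm_nonneg _)).1 h'
  have hdense : DenseRange f := by
    have := R'.cyclic
    rw [← Function.Surjective.range_comp hp] at this
    exact this
  let V : R'.H →L[ℂ] R.H := g.extendOfNorm f
  have hV : ∀ b, V (f b) = g b := fun b =>
    LinearMap.extendOfNorm_eq hdense ⟨1, fun b => by rw [one_mul, hnorm]⟩ b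
  have hVi : ∀ x y, ⟪V x, V y⟫_ℂ = ⟪x, y⟫_ℂ := by
    intro x y
    refine hdense.induction_on₂ (p := fun x y => ⟪V x, V y⟫_ℂ = ⟪x, y⟫_ℂ) ?_ ?_ x y
    · exact isClosed_eq (by fun_prop) (by fun_prop)
    · intro b c
      rw [hV, hV, hfg]
  have hVπ : ∀ b x, V (R'.π (p b) x) = R.π b (V x) := by
    intro b x
    refine hdense.induction_on (p := fun x => V (R'.π (p b) x) = R.π b (V x)) x
      (isClosed_eq (by fun_prop) (by fun_prop)) fun c => ?_
    have : R'.π (p b) (f c) = f (b * c) := by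
      change R'.π (p b) (R'.π (p c) R'.Ω) = R'.π (p (b * c)) R'.Ω
      rw [map_mul, R'.π_mul]
    rw [this, hV, hV]
    exact R.π_mul b c R.Ω
  have hVΩ : V R'.Ω = R.Ω := by
    have h1 : f 1 = R'.Ω := by simp [f]
    rw [← h1, hV]
    simp [g]
  have hVU : ∀ u ∈ U, ∀ x, R.π u (V x) = V x := by
    intro u hu x
    refine hdense.induction_on (p := fun x => R.π u (V x) = V x) x
      (isClosed_eq (by fun_prop) (by fun_prop)) fun c => ?_
    rw [hV]
    change R.π u (R.π c R.Ω) = R.π c R.Ω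
    rw [← R.π_mul, hT.commute c c.2 u hu, R.π_mul, hUB u hu]
  refine ⟨⟨V, hVi, hVπ, hVΩ, hVU, fun x hx => ?_⟩⟩
  -- The component `y = x - V V* x` of a fixed vector `x` is fixed, so it is orthogonal to
  -- `π(T i) Ω` for the twisted `T i`; for the `T i` in `B` it is so because `π(T i) Ω` is in the range of
  -- `V`.
  have hy : ∀ u ∈ U, R.π u (x - V (adjoint V x)) = x - V (adjoint V x) := by
    intro u hu
    rw [map_sub, hx u hu, hVU u hu]
  have hVy : ∀ z, ⟪V z, x - V (adjoint V x)⟫_ℂ = 0 := by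
    intro z
    rw [inner_sub_right, hVi, adjoint_inner_right, sub_self]
  refine (sub_eq_zero.1 (R.eq_zero_of_forall_inner fun a => ?_)).symm
  rw [← inner_conj_symm]
  have key := hT.eq_zero_of_continuous
    ((innerSL ℂ (x - V (adjoint V x))).toLinearMap ∘ₗ
      (ContinuousLinearMap.apply ℂ R.H R.Ω).toLinearMap ∘ₗ R.π.toLinearMap)
    (by
      change Continuous fun a => ⟪x - V (adjoint V x), R.π a R.Ω⟫_ℂ
      fun_prop) (fun i => ?_) a
  · change ⟪x - V (adjoint V x), R.π a R.Ω⟫_ℂ = 0 at key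
    rw [key, map_zero]
  · change ⟪x - V (adjoint V x), R.π (T i) R.Ω⟫_ℂ = 0
    rcases hT.mem_or_twisted' i with h | ⟨u, hu, θ, hθ, h⟩
    · have := hVy (R'.π (p ⟨T i, h⟩) R'.Ω)
      rw [hVπ, hVΩ] at this
      rw [← inner_conj_symm, this, map_zero]
    · exact inner_twisted (hT.star_mul_stabilizer u hu) hθ h (hy u hu) (hUB u hu)

end ErrorBasis

end Corner

/-! ### Commutants, centers and irreducibility -/

section Corner

variable {A L : Type*} [Ring A] [StarRing A] [Algebra ℂ A]
  [Ring L] [StarRing L] [Algebra ℂ L]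
  {ω : State A} {ω' : State L}

/-- Operators which agree on the vectors `π(a) Ω` are equal. -/
theorem GNSTriple.ext_clm {R : GNSTriple.{w} ω} {M : Type*} [AddCommGroup M] [Module ℂ M]
    [TopologicalSpace M] [T2Space M] {S S' : R.H →L[ℂ] M}
    (h : ∀ a, S (R.π a R.Ω) = S' (R.π a R.Ω)) : S = S' := by
  refine ContinuousLinearMap.coeFn_injective (Continuous.ext_on R.cyclic S.continuous
    S'.continuous ?_)
  rintro _ ⟨a, rfl⟩
  exact h a

/-- The center of `π(A)''` is the center of the commutant `π(A)'`. -/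
theorem GNSTriple.mem_center_iff {R : GNSTriple.{w} ω} (S : R.commutant) :
    (S : R.H →L[ℂ] R.H) ∈ R.center ↔ ∀ S' : R.commutant, S * S' = S' * S := by
  rw [center, StarSubalgebra.mem_inf, mem_vonNeumann]
  constructor
  · rintro ⟨h, -⟩ S'
    ext x
    exact h S' S'.2 x
  · intro h
    refine ⟨fun S' hS' x => ?_, S.2⟩
    exact congrArg (fun X : R.commutant => (X : R.H →L[ℂ] R.H) x) (h ⟨S', hS'⟩)

theorem GNSTriple.mem_center_map {R : GNSTriple.{w} ω} {R' : GNSTriple.{w'} ω'}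
    (e : R.commutant ≃⋆ₐ[ℂ] R'.commutant) {S : R.commutant}
    (hS : (S : R.H →L[ℂ] R.H) ∈ R.center) : (e S : R'.H →L[ℂ] R'.H) ∈ R'.center := by
  rw [mem_center_iff] at hS ⊢
  intro S'
  obtain ⟨S', rfl⟩ : ∃ S₁, e S₁ = S' := ⟨e.symm S', e.apply_symm_apply S'⟩
  rw [← map_mul, hS, map_mul]

/-- An isomorphism of the commutants restricts to an isomorphism of the centers. -/
def GNSTriple.centerEquiv {R : GNSTriple.{w} ω} {R' : GNSTriple.{w'} ω'}
    (e : R.commutant ≃⋆ₐ[ℂ] R'.commutant) : R.center ≃⋆ₐ[ℂ] R'.center where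
  toFun S := ⟨e ⟨S, S.2.2⟩, mem_center_map e S.2⟩
  invFun S := ⟨e.symm ⟨S, S.2.2⟩, mem_center_map e.symm S.2⟩
  left_inv S := Subtype.ext (show (e.symm (e ⟨S, S.2.2⟩)).1 = S.1 by
    rw [e.symm_apply_apply])
  right_inv S := Subtype.ext (show (e (e.symm ⟨S, S.2.2⟩)).1 = S.1 by
    rw [e.apply_symm_apply])
  map_mul' S S' := Subtype.ext (show (e (⟨S, S.2.2⟩ * ⟨S', S'.2.2⟩)).1 =
    (e ⟨S, S.2.2⟩ * e ⟨S', S'.2.2⟩).1 by rw [map_mul])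
  map_add' S S' := Subtype.ext (show (e (⟨S, S.2.2⟩ + ⟨S', S'.2.2⟩)).1 =
    (e ⟨S, S.2.2⟩ + e ⟨S', S'.2.2⟩).1 by rw [map_add])
  map_star' S := Subtype.ext (show (e (star ⟨S, S.2.2⟩)).1 = (star (e ⟨S, S.2.2⟩)).1 by
    rw [map_star])
  map_smul' z S := Subtype.ext (show (e (z • ⟨S, S.2.2⟩)).1 = (z • e ⟨S, S.2.2⟩).1 by
    rw [map_smul])

theorem GNSTriple.IsFactor.of_centerEquiv {R : GNSTriple.{w} ω} {R' : GNSTriple.{w'} ω'}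
    (e : R.center ≃⋆ₐ[ℂ] R'.center) (h : R.IsFactor) : R'.IsFactor := by
  rw [IsFactor, eq_bot_iff]
  intro S hS
  have h1 : ((e.symm ⟨S, hS⟩ : R.center) : R.H →L[ℂ] R.H) ∈ (⊥ : StarSubalgebra ℂ _) :=
    h ▸ (e.symm ⟨S, hS⟩).2
  obtain ⟨z, hz⟩ := StarSubalgebra.mem_bot.1 h1
  have h2 : e.symm ⟨S, hS⟩ = z • (1 : R.center) := Subtype.ext (by
    rw [← hz, Algebra.algebraMap_eq_smul_one]; rfl)
  have h3 := e.apply_symm_apply ⟨S, hS⟩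
  rw [h2, map_smul, map_one] at h3
  refine StarSubalgebra.mem_bot.2 ⟨z, ?_⟩
  rw [Algebra.algebraMap_eq_smul_one]
  exact congrArg Subtype.val h3

theorem GNSTriple.invariant_orthogonal {R : GNSTriple.{w} ω} {K : Submodule ℂ R.H}
    (hK : ∀ a, ∀ x ∈ K, R.π a x ∈ K) (a : A) : ∀ x ∈ Kᗮ, R.π a x ∈ Kᗮ := by
  intro x hx y hy
  rw [R.inner_π]
  exact hx _ (hK _ y hy)

theorem GNSTriple.eq_top_of_Ω_mem {R : GNSTriple.{w} ω} {K : Submodule ℂ R.H}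
    (hc : IsClosed (K : Set R.H)) (hK : ∀ a, ∀ x ∈ K, R.π a x ∈ K) (hΩ : R.Ω ∈ K) : K = ⊤ := by
  rw [eq_top_iff]
  intro x _
  have h1 : Set.range (fun a => R.π a R.Ω) ⊆ (K : Set R.H) := by
    rintro _ ⟨a, rfl⟩
    exact hK a _ hΩ
  have := closure_minimal h1 hc
  rw [R.cyclic.closure_eq] at this
  exact this (Set.mem_univ x)

variable [StarModule ℂ A] {B : StarSubalgebra ℂ A}

namespace Corner

variable {R : GNSTriple.{w} ω} {R' : GNSTriple.{w'} ω'} {p : B →ₐ[ℂ] L} {U : Set A}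
  (c : Corner R R' p U)

theorem adjoint_V (x : R'.H) : adjoint c.V (c.V x) = x :=
  ext_inner_left ℂ fun y => by rw [adjoint_inner_right, c.inner_map]

theorem V_injective : Function.Injective c.V := fun x y h => by
  rw [← c.adjoint_V x, h, c.adjoint_V]

/-- The compression `S ↦ V* S V` of an operator to the corner. -/
def compress (S : R.H →L[ℂ] R.H) : R'.H →L[ℂ] R'.H := adjoint c.V ∘L S ∘L c.V

theorem compress_apply (S : R.H →L[ℂ] R.H) (x : R'.H) :
    c.compress S x = adjoint c.V (S (c.V x)) := rfl

theorem inner_compress (S : R.H →L[ℂ] R.H) (x y : R'.H) :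
    ⟪x, c.compress S y⟫_ℂ = ⟪c.V x, S (c.V y)⟫_ℂ := by
  rw [compress_apply, adjoint_inner_right]

theorem compress_star (S : R.H →L[ℂ] R.H) : c.compress (star S) = star (c.compress S) := by
  ext x
  refine ext_inner_left ℂ fun y => ?_
  rw [inner_compress, star_eq_adjoint, star_eq_adjoint, adjoint_inner_right, adjoint_inner_right,
    compress_apply, adjoint_inner_left]

theorem compress_add (S T : R.H →L[ℂ] R.H) : c.compress (S + T) = c.compress S + c.compress T := by
  ext x; simp [compress_apply]

theorem compress_smul (z : ℂ) (S : R.H →L[ℂ] R.H) : c.compress (z • S) = z • c.compress S := by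
  ext x; simp [compress_apply]

theorem compress_one : c.compress 1 = 1 := by
  ext x; simp [compress_apply, c.adjoint_V]

theorem compress_π_mem (b : B) : c.compress (R.π b) = R'.π (p b) := by
  ext x
  rw [compress_apply, ← c.map_π, c.adjoint_V]

/-- Elements of the commutant preserve the fixed vectors, so that compressing them means
restricting them. -/
theorem V_compress {S : R.H →L[ℂ] R.H} (hS : S ∈ R.commutant) (x : R'.H) :
    c.V (c.compress S x) = S (c.V x) := by
  refine c.V_adjoint_of_fixed _ fun u hu => ?_
  change R.π u (S (c.V x)) = S (c.V x)
  rw [← R.mem_commutant.1 hS, c.fixed_V u hu]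

theorem compress_mul_of_commutant (S : R.H →L[ℂ] R.H) {S' : R.H →L[ℂ] R.H}
    (hS' : S' ∈ R.commutant) : c.compress (S * S') = c.compress S * c.compress S' := by
  ext x
  rw [mul_apply_eq_comp, c.compress_apply S, c.V_compress hS', c.compress_apply, mul_apply_eq_comp]

theorem compress_mul_of_commutant' {S : R.H →L[ℂ] R.H} (hS : S ∈ R.commutant)
    (S' : R.H →L[ℂ] R.H) : c.compress (S * S') = c.compress S * c.compress S' := by
  rw [← star_star (c.compress (S * S')), ← compress_star, star_mul,
    c.compress_mul_of_commutant _ (star_mem hS), compress_star, compress_star, star_mul,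
    star_star, star_star]

theorem compress_mem_commutant (hp : Function.Surjective p) {S : R.H →L[ℂ] R.H}
    (hS : S ∈ R.commutant) : c.compress S ∈ R'.commutant := by
  rw [GNSTriple.mem_commutant]
  intro l x
  obtain ⟨b, rfl⟩ := hp l
  refine c.V_injective ?_
  rw [c.V_compress hS, c.map_π, c.map_π, c.V_compress hS, R.mem_commutant.1 hS]

/-- An operator is determined by the compressions of its translates `π(a)* S π(b)`, since the
vectors `π(b) V x` are total. -/
theorem eq_of_compress_eq {S S' : R.H →L[ℂ] R.H}
    (h : ∀ a b, c.compress (R.π (star a) * S * R.π b) = c.compress (R.π (star a) * S' * R.π b)) :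
    S = S' := by
  refine R.ext_clm fun b => sub_eq_zero.1 (R.eq_zero_of_forall_inner fun a => ?_)
  have := congrArg (fun T : R'.H →L[ℂ] R'.H => ⟪R'.Ω, T R'.Ω⟫_ℂ) (h a b)
  simp only [inner_compress, mul_apply_eq_comp, c.map_Ω] at this
  rw [inner_sub_right, sub_eq_zero, ← star_star a, ← R.inner_π, ← R.inner_π, this]

variable [TopologicalSpace A] {ι : Type*} {T : ι → A}

/-- The compression of `T i* T j` vanishes unless `T i* T j ∈ B`. -/
theorem compress_twisted (hT : ErrorBasis B U T) {i j : ι} (h : star (T i) * T j ∉ B) :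
    c.compress (R.π (star (T i) * T j)) = 0 := by
  obtain ⟨u, hu, θ, hθ, h⟩ := (hT.mem_or_twisted i j).resolve_left h
  ext x
  refine ext_inner_left ℂ fun y => ?_
  rw [inner_compress, ErrorBasis.inner_twisted (hT.star_mul_stabilizer u hu) hθ h
    (c.fixed_V u hu _) (c.fixed_V u hu _)]
  simp

theorem continuous_compress : Continuous c.compress := by
  unfold compress
  fun_prop

/-- The compression of `π(A)` commutes with `π'(L)'`: on the error basis it is `0` or in `π'(L)`. -/
theorem compress_π_commute (hT : ErrorBasis B U T) (hR : Continuous R.π)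
    {S : R'.H →L[ℂ] R'.H} (hS : S ∈ R'.commutant) (a : A) :
    c.compress (R.π a) * S = S * c.compress (R.π a) := by
  let f : A →ₗ[ℂ] (R'.H →L[ℂ] R'.H) :=
    { toFun := fun a => c.compress (R.π a) * S - S * c.compress (R.π a)
      map_add' := fun a b => by rw [map_add, compress_add, add_mul, mul_add]; abel
      map_smul' := fun z a => by
        rw [map_smul, compress_smul, smul_mul_assoc, mul_smul_comm, ← smul_sub]; rfl }
  refine sub_eq_zero.1 (hT.eq_zero_of_continuous f ?_ (fun j => sub_eq_zero.2 ?_) a)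
  · have := c.continuous_compress.comp hR
    exact (this.mul continuous_const).sub (continuous_const.mul this)
  · by_cases h : T j ∈ B
    · rw [c.compress_π_mem ⟨T j, h⟩]
      ext x
      exact (R'.mem_commutant.1 hS _ _).symm
    · obtain ⟨i, hi⟩ := hT.exists_eq_one
      have := c.compress_twisted hT (i := i) (j := j) (by rwa [hi, star_one, one_mul])
      rw [hi, star_one, one_mul] at this
      rw [this, zero_mul, mul_zero]

/-- Every operator `S` in `π'(L)'` extends to an element of `π(A)'`, namely to
`π(a) V x ↦ π(a) V S x`. -/
theorem exists_extension (hT : ErrorBasis B U T) (hR : Continuous R.π)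
    {S : R'.H →L[ℂ] R'.H} (hS : S ∈ R'.commutant) :
    ∃ S₁ ∈ R.commutant, ∀ x, S₁ (c.V x) = c.V (S x) := by
  let ρ : R'.commutant →ₗ[ℂ] (A × R'.H → R.H) :=
    { toFun := fun S j => R.π j.1 (c.V ((S : R'.H →L[ℂ] R'.H) j.2))
      map_add' := fun S S' => by ext j; simp
      map_smul' := fun z S => by ext j; simp }
  obtain ⟨Ψ, hΨ⟩ := R'.closedUnderSqrt_commutant.exists_starAlgHom ρ (fun S S' j k => by
      change ⟪R.π j.1 (c.V ((S : R'.H →L[ℂ] R'.H) j.2)),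
        R.π k.1 (c.V ((S' : R'.H →L[ℂ] R'.H) k.2))⟫_ℂ = ⟪R.π j.1 (c.V j.2),
        R.π k.1 (c.V (star (S : R'.H →L[ℂ] R'.H) ((S' : R'.H →L[ℂ] R'.H) k.2)))⟫_ℂ
      rw [← star_star j.1, ← R.inner_π, ← R.inner_π, ← R.π_mul, ← R.π_mul, ← inner_compress,
        ← inner_compress, ← adjoint_inner_right, ← star_eq_adjoint]
      have := c.compress_π_commute hT hR (S := star (S : R'.H →L[ℂ] R'.H)) (star_mem S.2)
        (star j.1 * k.1)
      exact congrArg (fun X : R'.H →L[ℂ] R'.H => ⟪j.2, X ((S' : R'.H →L[ℂ] R'.H) k.2)⟫_ℂ) this.symm)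
    (R.cyclic.mono (by
      rintro _ ⟨a, rfl⟩
      refine Submodule.subset_span ⟨(a, R'.Ω), ?_⟩
      change R.π a (c.V R'.Ω) = _
      rw [c.map_Ω]))
  have h1 : ∀ a x, Ψ ⟨S, hS⟩ (R.π a (c.V x)) = R.π a (c.V (S x)) := by
    intro a x
    have := hΨ ⟨S, hS⟩ 1 (a, x)
    rwa [mul_one] at this
  refine ⟨Ψ ⟨S, hS⟩, ?_, fun x => by simpa using h1 1 x⟩
  rw [GNSTriple.mem_commutant]
  intro b x
  have : Ψ ⟨S, hS⟩ ∘L R.π b = R.π b ∘L Ψ ⟨S, hS⟩ := R.ext_clm fun a => by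
    rw [coe_comp, coe_comp, Function.comp_apply, Function.comp_apply, ← R.π_mul, ← c.map_Ω, h1, h1,
      R.π_mul]
  exact congrArg (fun X : R.H →L[ℂ] R.H => X x) this

theorem exists_compress_eq (hT : ErrorBasis B U T) (hR : Continuous R.π)
    {S : R'.H →L[ℂ] R'.H} (hS : S ∈ R'.commutant) : ∃ S₁ ∈ R.commutant, c.compress S₁ = S := by
  obtain ⟨S₁, h1, h2⟩ := c.exists_extension hT hR hS
  refine ⟨S₁, h1, ?_⟩
  ext x
  rw [compress_apply, h2, c.adjoint_V]

/-- The compression `S ↦ V* S V`, which is multiplicative on the commutant. -/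
def compressCommutant (hp : Function.Surjective p) : R.commutant →⋆ₐ[ℂ] R'.commutant where
  toFun S := ⟨c.compress S, c.compress_mem_commutant hp S.2⟩
  map_one' := Subtype.ext c.compress_one
  map_mul' S S' := Subtype.ext (c.compress_mul_of_commutant S S'.2)
  map_zero' := Subtype.ext (by simpa using c.compress_smul 0 0)
  map_add' S S' := Subtype.ext (c.compress_add S S')
  commutes' z := Subtype.ext (by
    have := c.compress_smul z 1
    rw [compress_one] at this
    simpa [Algebra.algebraMap_eq_smul_one] using this)
  map_star' S := Subtype.ext (c.compress_star S)

theorem compressCommutant_injective (hp : Function.Surjective p) :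
    Function.Injective (c.compressCommutant hp) := by
  intro S S' h
  have h' : c.compress S = c.compress S' := congrArg Subtype.val h
  refine Subtype.ext (R.ext_clm fun a => ?_)
  rw [R.mem_commutant.1 S.2, R.mem_commutant.1 S'.2, ← c.map_Ω, ← c.V_compress S.2, h',
    c.V_compress S'.2]

/-- Compression to the corner is an isomorphism `π(A)' ≃ π'(L)'` of the commutants. -/
def commutantEquiv (hT : ErrorBasis B U T) (hR : Continuous R.π) (hp : Function.Surjective p) :
    R.commutant ≃⋆ₐ[ℂ] R'.commutant :=
  StarAlgEquiv.ofBijective (c.compressCommutant hp) ⟨c.compressCommutant_injective hp, fun S => by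
    obtain ⟨S₁, h1, h2⟩ := c.exists_compress_eq hT hR S.2
    exact ⟨⟨S₁, h1⟩, Subtype.ext h2⟩⟩

end Corner

namespace Corner

variable {R : GNSTriple.{w} ω} {R' : GNSTriple.{w'} ω'} {p : B →ₐ[ℂ] L} {U : Set A}

/-- For an invariant subspace `K` of `R`, the subspace `V⁻¹ K` is invariant. If it is everything,
then `Ω ∈ K`; if it is zero, then `K` contains no nonzero fixed vectors and `Ω` is orthogonal to `K`. -/
theorem isIrreducible_of_compressed (c : Corner R R' p U) (hp : Function.Surjective p)
    (h : R'.IsIrreducible) : R.IsIrreducible := by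
  refine ⟨⟨⟨R.Ω, 0, R.Ω_ne_zero⟩⟩, fun K hc hK => ?_⟩
  have hKc : CompleteSpace K := hc.completeSpace_coe
  rcases h.2 (K.comap (c.V : R'.H →ₗ[ℂ] R.H)) (hc.preimage c.V.continuous) (fun l x hx => by
    obtain ⟨b, rfl⟩ := hp l
    change c.V _ ∈ K
    rw [c.map_π]
    exact hK _ _ hx) with h0 | h1
  · left
    -- The component `y` of `Ω` in `K` is fixed by the stabilizers, because `K` and its complement
    -- are both invariant.
    obtain ⟨y, hy, z, hz, hyz⟩ := K.exists_add_mem_mem_orthogonal R.Ω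
    have hyu : ∀ u ∈ U, R.π u y = y := by
      intro u hu
      have h2 : R.π u R.Ω = R.Ω := by rw [← c.map_Ω, c.fixed_V u hu]
      rw [hyz, map_add] at h2
      have h3 : R.π u y - y ∈ K := sub_mem (hK _ _ hy) hy
      have h4 : R.π u y - y ∈ Kᗮ := by
        have : R.π u y - y = z - R.π u z := by
          rw [sub_eq_sub_iff_add_eq_add, h2, add_comm]
        rw [this]
        exact sub_mem hz (GNSTriple.invariant_orthogonal hK _ _ hz)
      exact sub_eq_zero.1 ((inner_self_eq_zero (𝕜 := ℂ)).1 (h4 _ h3))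
    have h5 := c.V_adjoint_of_fixed y hyu
    have h6 : adjoint c.V y ∈ K.comap (c.V : R'.H →ₗ[ℂ] R.H) := by
      change c.V _ ∈ K
      rwa [h5]
    rw [h0, Submodule.mem_bot] at h6
    rw [h6, map_zero] at h5
    rw [← h5, zero_add] at hyz
    have h7 : Kᗮ = ⊤ := GNSTriple.eq_top_of_Ω_mem K.isClosed_orthogonal
      (GNSTriple.invariant_orthogonal hK) (hyz ▸ hz)
    rwa [Submodule.orthogonal_eq_top_iff] at h7
  · right
    refine GNSTriple.eq_top_of_Ω_mem hc hK ?_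
    rw [← c.map_Ω]
    exact (h1 ▸ Submodule.mem_top : R'.Ω ∈ K.comap (c.V : R'.H →ₗ[ℂ] R.H))

/-- An invariant subspace `K` of `R'` generates the closed span of `π(A) V K`, and is recovered from
it by `V*`, because the compression of `π(A)` preserves `K`. -/
theorem isIrreducible_compressed (c : Corner R R' p U) [TopologicalSpace A] {ι : Type*} {T : ι → A}
    (hT : ErrorBasis B U T) (hR : Continuous R.π) (h : R.IsIrreducible) : R'.IsIrreducible := by
  refine ⟨⟨⟨R'.Ω, 0, R'.Ω_ne_zero⟩⟩, fun K hc hK => ?_⟩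
  have hcomp : ∀ x ∈ K, ∀ a, adjoint c.V (R.π a (c.V x)) ∈ K := by
    intro x hx a
    have hq : IsClosed ((K : Submodule ℂ R'.H) : Set R'.H) := hc
    have := hT.eq_zero_of_continuous (M := R'.H ⧸ K)
      (K.mkQ ∘ₗ (adjoint c.V).toLinearMap ∘ₗ
        (ContinuousLinearMap.apply ℂ R.H (c.V x)).toLinearMap ∘ₗ R.π.toLinearMap)
      (by
        change Continuous fun a => K.mkQ (adjoint c.V (R.π a (c.V x)))
        have h1 : Continuous K.mkQ := continuous_quot_mk
        refine h1.comp ?_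
        fun_prop)
      (fun j => by
        change K.mkQ (c.compress (R.π (T j)) x) = 0
        rw [Submodule.mkQ_apply, Submodule.Quotient.mk_eq_zero]
        by_cases hj : T j ∈ B
        · rw [c.compress_π_mem ⟨T j, hj⟩]
          exact hK _ _ hx
        · obtain ⟨i, hi⟩ := hT.exists_eq_one
          have := c.compress_twisted hT (i := i) (j := j) (by rwa [hi, star_one, one_mul])
          rw [hi, star_one, one_mul] at this
          rw [this]
          exact zero_mem _) a
    exact (Submodule.Quotient.mk_eq_zero K).1 this
  let K₁ : Submodule ℂ R.H := Submodule.span ℂ {y | ∃ a, ∃ x ∈ K, y = R.π a (c.V x)}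
  have hK₁ : ∀ a, ∀ y ∈ K₁, R.π a y ∈ K₁ := by
    intro a y hy
    have : K₁ ≤ K₁.comap (R.π a : R.H →ₗ[ℂ] R.H) := by
      refine Submodule.span_le.2 ?_
      rintro _ ⟨b, x, hx, rfl⟩
      refine Submodule.subset_span ⟨a * b, x, hx, (R.π_mul a b _).symm⟩
    exact this hy
  rcases h.2 K₁.topologicalClosure K₁.isClosed_topologicalClosure (fun a y hy =>
    map_mem_closure (R.π a).continuous hy (hK₁ a)) with h0 | h1
  · left
    rw [eq_bot_iff]
    intro x hx
    have h2 : c.V x ∈ K₁.topologicalClosure := K₁.le_topologicalClosure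
      (Submodule.subset_span ⟨1, x, hx, by simp⟩)
    rw [h0, Submodule.mem_bot] at h2
    exact c.V_injective (by rw [h2, map_zero])
  · right
    rw [eq_top_iff]
    intro x _
    have h2 : c.V x ∈ K₁.topologicalClosure := h1 ▸ Submodule.mem_top
    have h3 : K₁ ≤ K.comap (adjoint c.V : R.H →ₗ[ℂ] R'.H) := by
      refine Submodule.span_le.2 ?_
      rintro _ ⟨a, x, hx, rfl⟩
      exact hcomp x hx a
    have h4 := closure_minimal (s := (K₁ : Set R.H)) h3 (hc.preimage (adjoint c.V).continuous) h2
    change adjoint c.V (c.V x) ∈ K at h4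
    rwa [c.adjoint_V] at h4

end Corner

end Corner

/-! ### Corners of von Neumann algebras, and quasi-equivalence of the compressions -/

section CornerEquiv

variable {M₁ M₂ N₁ N₂ : Type*} [Ring M₁] [Ring M₂] [Ring N₁] [Ring N₂] [StarRing M₁] [StarRing M₂]
  [StarRing N₁] [StarRing N₂] [Algebra ℂ M₁] [Algebra ℂ M₂] [Algebra ℂ N₁] [Algebra ℂ N₂]

/-- Let `Nᵢ` be identified by the embedding `eᵢ` and the compression `kᵢ` with the corner
`Pᵢ Mᵢ Pᵢ`, where `Pᵢ = eᵢ 1`. An isomorphism `M₁ ≃ M₂` which maps `P₁` to `P₂` induces an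
isomorphism `N₁ ≃ N₂`. -/
theorem exists_corner_equiv (e₁ : N₁ →ₗ[ℂ] M₁) (e₂ : N₂ →ₗ[ℂ] M₂)
    (k₁ : M₁ →ₗ[ℂ] N₁) (k₂ : M₂ →ₗ[ℂ] N₂)
    (he₁ : ∀ y y', e₁ (y * y') = e₁ y * e₁ y')
    (he₁s : ∀ y, e₁ (star y) = star (e₁ y))
    (hke₁ : ∀ y, k₁ (e₁ y) = y) (hke₂ : ∀ y, k₂ (e₂ y) = y)
    (hek₁ : ∀ m, e₁ (k₁ m) = e₁ 1 * m * e₁ 1) (hek₂ : ∀ m, e₂ (k₂ m) = e₂ 1 * m * e₂ 1)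
    (hk₂ : ∀ m m', k₂ (m * e₂ 1 * m') = k₂ m * k₂ m') (hk₂s : ∀ m, k₂ (star m) = star (k₂ m))
    (τ : M₁ ≃⋆ₐ[ℂ] M₂) (hP : τ (e₁ 1) = e₂ 1) :
    ∃ τ' : N₁ ≃⋆ₐ[ℂ] N₂, ∀ m, τ' (k₁ m) = k₂ (τ m) := by
  have hP' : τ.symm (e₂ 1) = e₁ 1 := by rw [← hP, τ.symm_apply_apply]
  have key1 : ∀ m, e₂ (k₂ (τ m)) = τ (e₁ (k₁ m)) := by
    intro m
    rw [hek₂, hek₁, map_mul, map_mul, hP]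
  have key2 : ∀ m, e₁ (k₁ (τ.symm m)) = τ.symm (e₂ (k₂ m)) := by
    intro m
    rw [hek₂, hek₁, map_mul, map_mul, hP']
  refine ⟨{ toFun := fun y => k₂ (τ (e₁ y))
            invFun := fun y => k₁ (τ.symm (e₂ y))
            left_inv := fun y => by
              beta_reduce
              rw [key1, τ.symm_apply_apply, hke₁, hke₁]
            right_inv := fun y => by
              beta_reduce
              rw [key2, τ.apply_symm_apply, hke₂, hke₂]
            map_mul' := fun y y' => by
              rw [← hk₂, ← hP, ← map_mul, ← map_mul, ← he₁, ← he₁, mul_one]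
            map_add' := fun y y' => by rw [map_add, map_add, map_add]
            map_star' := fun y => by rw [he₁s, map_star, hk₂s]
            map_smul' := fun z y => by rw [map_smul, map_smul, map_smul] }, fun m => ?_⟩
  change k₂ (τ (e₁ (k₁ m))) = k₂ (τ m)
  rw [← key1, hke₂]

end CornerEquiv

section VonNeumann

variable {A L : Type*} [Ring A] [StarRing A] [Algebra ℂ A]
  [Ring L] [StarRing L] [Algebra ℂ L] {ω : State A} {ω' : State L}

/-- The operator `π(a)`, as an element of `π(A)''`. -/
def GNSTriple.πvN (R : GNSTriple.{w} ω) (a : A) : R.vonNeumann := ⟨R.π a, R.π_mem_vonNeumann a⟩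

theorem GNSTriple.πvN_mul (R : GNSTriple.{w} ω) (a b : A) :
    R.πvN (a * b) = R.πvN a * R.πvN b := Subtype.ext (map_mul R.π a b)

theorem GNSTriple.πvN_star (R : GNSTriple.{w} ω) (a : A) :
    R.πvN (star a) = star (R.πvN a) := Subtype.ext (map_star R.π a)

variable [StarModule ℂ A] {B : StarSubalgebra ℂ A}

namespace Corner

variable {R : GNSTriple.{w} ω} {R' : GNSTriple.{w'} ω'} {p : B →ₐ[ℂ] L} {U : Set A}
  (c : Corner R R' p U)

theorem adjoint_V_commutant {S : R.H →L[ℂ] R.H} (hS : S ∈ R.commutant) (x : R.H) :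
    adjoint c.V (S x) = c.compress S (adjoint c.V x) := by
  refine ext_inner_left ℂ fun y => ?_
  rw [adjoint_inner_right, ← adjoint_inner_left S, ← star_eq_adjoint,
    ← c.V_compress (star_mem hS), ← adjoint_inner_right, compress_star, star_eq_adjoint,
    adjoint_inner_left]

/-- The operator `V y V*`, which acts as `y` on the corner and as zero on its complement. -/
def expand (y : R'.H →L[ℂ] R'.H) : R.H →L[ℂ] R.H := c.V ∘L y ∘L adjoint c.V

theorem expand_apply (y : R'.H →L[ℂ] R'.H) (x : R.H) :
    c.expand y x = c.V (y (adjoint c.V x)) := rfl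

theorem expand_mem_vonNeumann (hp : Function.Surjective p) {y : R'.H →L[ℂ] R'.H}
    (hy : y ∈ R'.vonNeumann) : c.expand y ∈ R.vonNeumann := by
  rw [GNSTriple.mem_vonNeumann]
  intro S hS x
  rw [expand_apply, expand_apply, c.adjoint_V_commutant hS,
    R'.mem_vonNeumann.1 hy _ (c.compress_mem_commutant hp hS), c.V_compress hS]

theorem expand_star (y : R'.H →L[ℂ] R'.H) : c.expand (star y) = star (c.expand y) := by
  ext x
  refine ext_inner_left ℂ fun z => ?_
  rw [star_eq_adjoint, star_eq_adjoint, adjoint_inner_right, expand_apply, expand_apply,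
    ← adjoint_inner_left, adjoint_inner_right, adjoint_inner_right]

theorem compress_mem_vonNeumann [TopologicalSpace A] {ι : Type*} {T : ι → A}
    (hT : ErrorBasis B U T) (hR : Continuous R.π)
    {m : R.H →L[ℂ] R.H} (hm : m ∈ R.vonNeumann) : c.compress m ∈ R'.vonNeumann := by
  rw [GNSTriple.mem_vonNeumann]
  intro S hS x
  obtain ⟨S₁, h1, rfl⟩ := c.exists_compress_eq hT hR hS
  have h2 : m * S₁ = S₁ * m := by
    ext x
    exact R.mem_vonNeumann.1 hm _ h1 x
  rw [← mul_apply_eq_comp, ← c.compress_mul_of_commutant _ h1, h2,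
    c.compress_mul_of_commutant' h1, mul_apply_eq_comp]

/-- The compression `m ↦ V* m V`, as a map of the von Neumann algebras `π(A)'' → π'(L)''`. -/
def compressVN [TopologicalSpace A] {ι : Type*} {T : ι → A}
    (hT : ErrorBasis B U T) (hR : Continuous R.π) : R.vonNeumann →ₗ[ℂ] R'.vonNeumann where
  toFun m := ⟨c.compress m, c.compress_mem_vonNeumann hT hR m.2⟩
  map_add' m m' := Subtype.ext (c.compress_add m m')
  map_smul' z m := Subtype.ext (c.compress_smul z m)

/-- The map `y ↦ V y V*`, as a map of the von Neumann algebras `π'(L)'' → π(A)''`. Its value at `1`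
is the projection onto the fixed vectors of the stabilizers. -/
def expandVN (hp : Function.Surjective p) : R'.vonNeumann →ₗ[ℂ] R.vonNeumann where
  toFun y := ⟨c.expand y, c.expand_mem_vonNeumann hp y.2⟩
  map_add' y y' := Subtype.ext (by ext x; simp [expand_apply])
  map_smul' z y := Subtype.ext (by ext x; simp [expand_apply])

variable (hp : Function.Surjective p)

theorem expandVN_star (y : R'.vonNeumann) : c.expandVN hp (star y) = star (c.expandVN hp y) :=
  Subtype.ext (c.expand_star y)

theorem expandVN_mul (y y' : R'.vonNeumann) :
    c.expandVN hp (y * y') = c.expandVN hp y * c.expandVN hp y' := by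
  refine Subtype.ext ?_
  ext x
  change c.V (y.1 (y'.1 _)) = c.V (y.1 (adjoint c.V (c.V (y'.1 _))))
  rw [c.adjoint_V]

section

variable [TopologicalSpace A] {ι : Type*} {T : ι → A} (hT : ErrorBasis B U T)
  (hR : Continuous R.π)

theorem compressVN_expandVN (y : R'.vonNeumann) :
    c.compressVN hT hR (c.expandVN hp y) = y := by
  refine Subtype.ext ?_
  ext x
  change adjoint c.V (c.V (y.1 (adjoint c.V (c.V x)))) = _
  rw [c.adjoint_V, c.adjoint_V]

theorem expandVN_compressVN (m : R.vonNeumann) :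
    c.expandVN hp (c.compressVN hT hR m) = c.expandVN hp 1 * m * c.expandVN hp 1 := rfl

theorem compressVN_mul_mul (m m' : R.vonNeumann) :
    c.compressVN hT hR (m * c.expandVN hp 1 * m') = c.compressVN hT hR m * c.compressVN hT hR m' :=
  rfl

theorem compressVN_star (m : R.vonNeumann) :
    c.compressVN hT hR (star m) = star (c.compressVN hT hR m) := Subtype.ext (c.compress_star m)

theorem compressVN_π (b : B) : c.compressVN hT hR (R.πvN b) = R'.πvN (p b) :=
  Subtype.ext (c.compress_π_mem b)

end

theorem π_mul_expandVN {u : A} (hu : u ∈ U) :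
    R.πvN u * c.expandVN hp 1 = c.expandVN hp 1 := by
  refine Subtype.ext ?_
  ext x
  exact c.fixed_V u hu _

theorem expandVN_one_mul {m : R.vonNeumann} (hm : ∀ u ∈ U, R.πvN u * m = m) :
    c.expandVN hp 1 * m = m := by
  refine Subtype.ext ?_
  ext x
  refine c.V_adjoint_of_fixed _ fun u hu => ?_
  exact congrArg (fun X : R.vonNeumann => X.1 x) (hm u hu)

theorem expandVN_one_star : star (c.expandVN hp 1) = c.expandVN hp 1 := by
  rw [← expandVN_star, star_one]

end Corner

variable {ω₁ ω₂ : State A} {ω₁' ω₂' : State L} {p : B →ₐ[ℂ] L} {U : Set A}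
  {R₁ : GNSTriple.{w₁} ω₁} {R₂ : GNSTriple.{w₂} ω₂}
  {R₁' : GNSTriple.{w₃} ω₁'} {R₂' : GNSTriple.{w₄} ω₂'}

/-- An isomorphism which implements the quasi-equivalence of `R₁` and `R₂` maps the fixed-point
projection of `R₁` below the one of `R₂`, as `π₁(u) P₁ = P₁` for all stabilizers `u`. -/
theorem expandVN_one_mul_map (c₁ : Corner R₁ R₁' p U) (c₂ : Corner R₂ R₂' p U)
    (hp : Function.Surjective p) (τ : R₁.vonNeumann ≃⋆ₐ[ℂ] R₂.vonNeumann)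
    (hτ : ∀ a, τ (R₁.πvN a) = R₂.πvN a) :
    c₂.expandVN hp 1 * τ (c₁.expandVN hp 1) = τ (c₁.expandVN hp 1) :=
  c₂.expandVN_one_mul hp fun u hu => by rw [← hτ, ← map_mul, c₁.π_mul_expandVN hp hu]

/-- By symmetry and taking adjoints, the fixed-point projections correspond to each other. -/
theorem map_expandVN_one (c₁ : Corner R₁ R₁' p U) (c₂ : Corner R₂ R₂' p U)
    (hp : Function.Surjective p) (τ : R₁.vonNeumann ≃⋆ₐ[ℂ] R₂.vonNeumann)
    (hτ : ∀ a, τ (R₁.πvN a) = R₂.πvN a) : τ (c₁.expandVN hp 1) = c₂.expandVN hp 1 := by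
  have h1 := expandVN_one_mul_map c₁ c₂ hp τ hτ
  have h2 := expandVN_one_mul_map c₂ c₁ hp τ.symm fun a => by rw [← hτ, τ.symm_apply_apply]
  have h3 := congrArg τ h2
  rw [map_mul, τ.apply_symm_apply] at h3
  have h4 := congrArg star h3
  rw [star_mul, ← map_star τ, c₁.expandVN_one_star, c₂.expandVN_one_star, h1] at h4
  exact h4

/-- Quasi-equivalent representations have quasi-equivalent corners. -/
theorem QuasiEquivalent.compress (c₁ : Corner R₁ R₁' p U) (c₂ : Corner R₂ R₂' p U)
    (hp : Function.Surjective p) [TopologicalSpace A] {ι : Type*} {T : ι → A}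
    (hT : ErrorBasis B U T) (hR₁ : Continuous R₁.π) (hR₂ : Continuous R₂.π)
    (h : QuasiEquivalent R₁ R₂) : QuasiEquivalent R₁' R₂' := by
  obtain ⟨τ, hτ⟩ := h
  change ∀ a, τ (R₁.πvN a) = R₂.πvN a at hτ
  obtain ⟨τ', hτ'⟩ := exists_corner_equiv (c₁.expandVN hp) (c₂.expandVN hp)
    (c₁.compressVN hT hR₁) (c₂.compressVN hT hR₂) (c₁.expandVN_mul hp)
    (c₁.expandVN_star hp) (c₁.compressVN_expandVN hp hT hR₁) (c₂.compressVN_expandVN hp hT hR₂)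
    (c₁.expandVN_compressVN hp hT hR₁) (c₂.expandVN_compressVN hp hT hR₂)
    (c₂.compressVN_mul_mul hp hT hR₂) (c₂.compressVN_star hT hR₂)
    τ (map_expandVN_one c₁ c₂ hp τ hτ)
  refine ⟨τ', fun l => ?_⟩
  obtain ⟨b, rfl⟩ := hp l
  change τ' (R₁'.πvN (p b)) = R₂'.πvN (p b)
  rw [← c₁.compressVN_π hT hR₁, hτ', hτ, c₂.compressVN_π]

end VonNeumann

/-! ### Automatic normality of isomorphisms -/

section Normal

variable {H K : Type*} [NormedAddCommGroup H] [InnerProductSpace ℂ H] [CompleteSpace H]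
  [NormedAddCommGroup K] [InnerProductSpace ℂ K] [CompleteSpace K]
  {M : StarSubalgebra ℂ (H →L[ℂ] H)} {N : StarSubalgebra ℂ (K →L[ℂ] K)}

theorem isPositive_star_mul_self (x : H →L[ℂ] H) : (star x * x).IsPositive :=
  isPositive_adjoint_comp_self x

theorem ClosedUnderSqrt.isPositive_map (hM : ClosedUnderSqrt M) (τ : M →⋆ₐ[ℂ] N)
    {x : M} (hx : (x : H →L[ℂ] H).IsPositive) :
    (τ x : K →L[ℂ] K).IsPositive := by
  obtain ⟨b, hb, hbx⟩ := hM _ x.2 hx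
  have h1 : x = star ⟨b, hb⟩ * ⟨b, hb⟩ := Subtype.ext hbx.symm
  rw [h1, map_mul, map_star]
  exact isPositive_star_mul_self _

theorem ClosedUnderSqrt.map_le_map (hM : ClosedUnderSqrt M) (τ : M →⋆ₐ[ℂ] N)
    {x y : M} (h : (x : H →L[ℂ] H) ≤ y) :
    (τ x : K →L[ℂ] K) ≤ τ y := by
  rw [le_def] at h ⊢
  have h1 : ((y - x : M) : H →L[ℂ] H).IsPositive := h
  have h2 := hM.isPositive_map τ h1
  rw [map_sub] at h2
  exact h2

theorem ClosedUnderSqrt.norm_map_le (hM : ClosedUnderSqrt M) (τ : M →⋆ₐ[ℂ] N)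
    (x : M) : ‖(τ x : K →L[ℂ] K)‖ ≤ ‖(x : H →L[ℂ] H)‖ := by
  obtain ⟨z, hz, hxz⟩ := hM.exists_star_mul_self_add x.2
  have h1 : star x * x + star ⟨z, hz⟩ * ⟨z, hz⟩ =
      ((‖(x : H →L[ℂ] H)‖ ^ 2 : ℝ) : ℂ) • (1 : M) := Subtype.ext hxz
  have h2 := congrArg τ h1
  rw [map_add, map_mul, map_mul, map_star, map_star, map_smul, map_one] at h2
  refine opNorm_le_bound _ (norm_nonneg _) fun ξ => ?_
  have h3 := congrArg (fun X : N => ⟪ξ, (X : K →L[ℂ] K) ξ⟫_ℂ) h2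
  change ⟪ξ, (star (τ x : K →L[ℂ] K)) ((τ x : K →L[ℂ] K) ξ) +
    (star (τ ⟨z, hz⟩ : K →L[ℂ] K)) ((τ ⟨z, hz⟩ : K →L[ℂ] K) ξ)⟫_ℂ =
    ⟪ξ, ((‖(x : H →L[ℂ] H)‖ ^ 2 : ℝ) : ℂ) • ξ⟫_ℂ at h3
  rw [inner_add_right, star_eq_adjoint, star_eq_adjoint, adjoint_inner_right, adjoint_inner_right,
    inner_smul_right] at h3
  simp only [inner_self_eq_ofReal] at h3
  norm_cast at h3
  refine (sq_le_sq₀ (norm_nonneg _) (by positivity)).1 ?_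
  rw [mul_pow, ← h3]
  exact le_add_of_nonneg_right (by positivity)

/-- The positive operator `z` is the sum `∑ a_i* a_i`, in the sense of quadratic forms
(equivalently, in the strong operator topology). -/
structure IsStrongSum {ι : Type*} (a : ι → H →L[ℂ] H) (z : H →L[ℂ] H) : Prop where
  isPositive : z.IsPositive
  hasSum : ∀ ξ, HasSum (fun i => ‖a i ξ‖ ^ 2) (RCLike.re ⟪ξ, z ξ⟫_ℂ)

variable {ι : Type*}

theorem re_inner_sum_star_mul_self (s : Finset ι) (a : ι → H →L[ℂ] H) (ξ : H) :
    RCLike.re ⟪ξ, (∑ i ∈ s, star (a i) * a i) ξ⟫_ℂ = ∑ i ∈ s, ‖a i ξ‖ ^ 2 := by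
  rw [sum_apply, inner_sum, map_sum]
  refine Finset.sum_congr rfl fun i _ => ?_
  rw [mul_apply_eq_comp, star_eq_adjoint, adjoint_inner_right, inner_self_eq_ofReal]
  rfl

theorem isPositive_sum_star_mul_self (s : Finset ι) (a : ι → H →L[ℂ] H) :
    (∑ i ∈ s, star (a i) * a i).IsPositive :=
  isPositive_sum s fun i _ => isPositive_star_mul_self (a i)

theorem le_iff_re_inner {x y : H →L[ℂ] H} (hx : x.IsPositive) (hy : y.IsPositive) :
    x ≤ y ↔ ∀ ξ, RCLike.re ⟪ξ, x ξ⟫_ℂ ≤ RCLike.re ⟪ξ, y ξ⟫_ℂ := by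
  rw [le_def]
  constructor
  · intro h ξ
    have := h.re_inner_nonneg_right ξ
    rw [sub_apply, inner_sub_right, map_sub] at this
    linarith
  · intro h
    refine (isPositive_def').2 ⟨hy.isSelfAdjoint.sub hx.isSelfAdjoint, fun ξ => ?_⟩
    rw [reApplyInnerSelf_apply, ← inner_conj_symm, RCLike.conj_re, sub_apply, inner_sub_right,
      map_sub]
    linarith [h ξ]

theorem IsStrongSum.sum_le {a : ι → H →L[ℂ] H} {z : H →L[ℂ] H} (h : IsStrongSum a z)
    (s : Finset ι) : ∑ i ∈ s, star (a i) * a i ≤ z := by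
  rw [le_iff_re_inner (isPositive_sum_star_mul_self s a) h.isPositive]
  intro ξ
  rw [re_inner_sum_star_mul_self]
  exact sum_le_hasSum s (fun _ _ => by positivity) (h.hasSum ξ)

theorem IsStrongSum.le {a : ι → H →L[ℂ] H} {z y : H →L[ℂ] H} (h : IsStrongSum a z)
    (hy : ∀ s : Finset ι, ∑ i ∈ s, star (a i) * a i ≤ y) : z ≤ y := by
  have hy0 : y.IsPositive := by
    have := hy ∅
    rwa [Finset.sum_empty, nonneg_iff_isPositive] at this
  rw [le_iff_re_inner h.isPositive hy0]
  intro ξ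
  refine hasSum_le_of_sum_le (h.hasSum ξ) fun s => ?_
  rw [← re_inner_sum_star_mul_self]
  exact (le_iff_re_inner (isPositive_sum_star_mul_self s a) hy0).1 (hy s) ξ

theorem ClosedUnderSqrt.sum_map_le (hM : ClosedUnderSqrt M) (τ : M →⋆ₐ[ℂ] N)
    {a : ι → M} {z : M}
    (s : Finset ι) (h : ∑ i ∈ s, star (a i : H →L[ℂ] H) * (a i : H →L[ℂ] H) ≤ z) :
    ∑ i ∈ s, star (τ (a i) : K →L[ℂ] K) * (τ (a i) : K →L[ℂ] K) ≤ τ z := by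
  have h1 : ((∑ i ∈ s, star (a i) * a i : M) : H →L[ℂ] H) =
      ∑ i ∈ s, star (a i : H →L[ℂ] H) * (a i : H →L[ℂ] H) := by
    rw [AddSubmonoidClass.coe_finsetSum]; rfl
  rw [← h1] at h
  have h2 := hM.map_le_map τ h
  rw [map_sum, AddSubmonoidClass.coe_finsetSum] at h2
  have h3 : ∀ i, ((τ (star (a i) * a i) : N) : K →L[ℂ] K) =
      star (τ (a i) : K →L[ℂ] K) * (τ (a i) : K →L[ℂ] K) := fun i => by
    rw [map_mul, map_star]; rfl
  simpa only [h3] using h2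

/-- Isomorphisms preserve strong sums `z = ∑ a_i* a_i`, since `z` is the least upper bound of the
partial sums and both the isomorphism and its inverse are monotone. -/
theorem IsStrongSum.map_eq (hM : ClosedUnderSqrt M) (hN : ClosedUnderSqrt N) (τ : M ≃⋆ₐ[ℂ] N)
    {a : ι → M} {z : M} {z' : N}
    (hz : IsStrongSum (fun i => (a i : H →L[ℂ] H)) z)
    (hz' : IsStrongSum (fun i => (τ (a i) : K →L[ℂ] K)) z') : τ z = z' := by
  let f : M →⋆ₐ[ℂ] N :=
    StarAlgHomClass.toStarAlgHom τ
  let g : N →⋆ₐ[ℂ] M :=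
    StarAlgHomClass.toStarAlgHom τ.symm
  have hgf : ∀ x, g (f x) = x := τ.symm_apply_apply
  have hfg : ∀ x, f (g x) = x := τ.apply_symm_apply
  refine Subtype.ext (le_antisymm ?_ ?_)
  · have h1 : (z : H →L[ℂ] H) ≤ g z' := by
      refine hz.le fun s => ?_
      have := hN.sum_map_le g (a := fun i => f (a i)) s (hz'.sum_le s)
      simpa only [hgf] using this
    have h2 := hM.map_le_map f h1
    rwa [hfg] at h2
  · exact hz'.le fun s => hM.sum_map_le f s (hz.sum_le s)

end Normal

section Polarization

variable {M : Type*} [Ring M] [StarRing M] [Algebra ℂ M] [StarModule ℂ M]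
  {H K : Type*} [NormedAddCommGroup H] [InnerProductSpace ℂ H]
  [NormedAddCommGroup K] [InnerProductSpace ℂ K]

/-- Polarization, in the vector as well as in the algebra variable. -/
theorem inner_eq_of_forall_self (d : M →ₗ[ℂ] (K →ₗ[ℂ] H)) (t : M →ₗ[ℂ] (K →ₗ[ℂ] K))
    (h : ∀ m ξ, ⟪d m ξ, d m ξ⟫_ℂ = ⟪ξ, t (star m * m) ξ⟫_ℂ) (m m' : M) (ξ ξ' : K) :
    ⟪d m ξ, d m' ξ'⟫_ℂ = ⟪ξ, t (star m * m') ξ'⟫_ℂ := by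
  let β : M → M → K → K → ℂ := fun m m' ξ ξ' => ⟪d m ξ, d m' ξ'⟫_ℂ - ⟪ξ, t (star m * m') ξ'⟫_ℂ
  have hself : ∀ m ξ, β m m ξ ξ = 0 := fun m ξ => sub_eq_zero.2 (h m ξ)
  have hI : Complex.I ≠ 0 := Complex.I_ne_zero
  have h1 : ∀ m ξ ξ', β m m ξ ξ' = 0 := by
    intro m ξ ξ'
    have e1 : β m m (ξ + ξ') (ξ + ξ') = β m m ξ ξ + β m m ξ ξ' + β m m ξ' ξ + β m m ξ' ξ' := by
      simp only [β, map_add, inner_add_left, inner_add_right]; ring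
    have e2 : β m m (ξ + Complex.I • ξ') (ξ + Complex.I • ξ') =
        β m m ξ ξ + Complex.I * β m m ξ ξ' - Complex.I * β m m ξ' ξ + β m m ξ' ξ' := by
      simp only [β, map_add, map_smul, inner_add_left, inner_add_right, inner_smul_left,
        inner_smul_right, Complex.conj_I]
      ring_nf
      simp only [Complex.I_sq]
      ring
    simp only [hself] at e1 e2
    have e3 : Complex.I * (2 * β m m ξ ξ') = 0 := by linear_combination -Complex.I * e1 - e2
    simpa [hI] using e3
  have e1 : β (m + m') (m + m') ξ ξ' = β m m ξ ξ' + β m m' ξ ξ' + β m' m ξ ξ' + β m' m' ξ ξ' := by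
    simp only [β, map_add, LinearMap.add_apply, star_add, add_mul, mul_add, inner_add_left,
      inner_add_right]
    ring
  have e2 : β (m + Complex.I • m') (m + Complex.I • m') ξ ξ' =
      β m m ξ ξ' + Complex.I * β m m' ξ ξ' - Complex.I * β m' m ξ ξ' + β m' m' ξ ξ' := by
    simp only [β, map_add, LinearMap.add_apply, map_smul, LinearMap.smul_apply, star_add, star_smul,
      add_mul, mul_add, smul_mul_assoc, mul_smul_comm, inner_add_left,
      inner_add_right, inner_smul_left, inner_smul_right, Complex.conj_I, Complex.star_def]
    ring_nf
    simp only [Complex.I_sq]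
    ring
  simp only [h1] at e1 e2
  have e3 : Complex.I * (2 * β m m' ξ ξ') = 0 := by linear_combination -Complex.I * e1 - e2
  exact sub_eq_zero.1 (by simpa [hI] using e3)

end Polarization

/-! ### Matrices over the corner -/

section Transport

variable {A L : Type*} [Ring A] [StarRing A] [Algebra ℂ A] [StarModule ℂ A]
  [Ring L] [StarRing L] [Algebra ℂ L] {ω : State A} {ω' : State L}
  {B : StarSubalgebra ℂ A} {p : B →ₐ[ℂ] L} {U : Set A}
  [TopologicalSpace A] {ι : Type*} {T : ι → A}

/-- Two elements of an error basis have the same syndrome if they differ by an element of `B`; for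
Pauli operators, if they have the same commutation relations with the stabilizers. -/
def ErrorBasis.syndromeSetoid (hT : ErrorBasis B U T) : Setoid ι where
  r i j := star (T i) * T j ∈ B
  iseqv :=
    { refl := fun i => by rw [hT.star_mul_self]; exact one_mem B
      symm := fun {i j} h => by
        have := star_mem h
        rwa [star_mul, star_star] at this
      trans := fun {i j k} h h' => by
        have := mul_mem h h'
        rwa [mul_assoc, ← mul_assoc (T j), hT.mul_star_self, one_mul] at this }

namespace Corner

variable {R : GNSTriple.{w} ω} {R' : GNSTriple.{w'} ω'} (c : Corner R R' p U)

/-- The translate `T i ∘ V` of the corner, an isometry of the space of `R'` into that of `R`. -/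
def translate (hT : ErrorBasis B U T) (i : ι) : R'.H →ₗᵢ[ℂ] R.H :=
  ((R.π (T i) ∘L c.V : R'.H →L[ℂ] R.H) : R'.H →ₗ[ℂ] R.H).isometryOfInner fun x y => by
    change ⟪R.π (T i) (c.V x), R.π (T i) (c.V y)⟫_ℂ = _
    rw [R.inner_π, ← R.π_mul, hT.star_mul_self, map_one, one_apply_eq_self, c.inner_map]

theorem translate_apply (hT : ErrorBasis B U T) (i : ι) (x : R'.H) :
    c.translate hT i x = R.π (T i) (c.V x) := rfl

theorem inner_translate (hT : ErrorBasis B U T) (i : ι) (S : R.H →L[ℂ] R.H) (ζ ξ : R'.H) :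
    ⟪c.translate hT i ζ, S (c.V ξ)⟫_ℂ = ⟪ζ, c.compress (R.π (star (T i)) * S) ξ⟫_ℂ := by
  rw [translate_apply, inner_compress, mul_apply_eq_comp, R.inner_π (star (T i)), star_star]

/-- The space of `R` is the orthogonal sum of the translates of the corner, one per syndrome. -/
theorem isHilbertSum_translate (hT : ErrorBasis B U T) (hR : Continuous R.π) :
    IsHilbertSum ℂ (fun _ : Quotient hT.syndromeSetoid => R'.H)
      (fun σ => c.translate hT σ.out) := by
  refine IsHilbertSum.mk ?_ ?_
  · intro σ σ' hσ x y
    rw [translate_apply c hT σ'.out, inner_translate, ← map_mul, c.compress_twisted hT]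
    · simp
    · intro h
      refine hσ ?_
      rw [← σ.out_eq, ← σ'.out_eq]
      exact Quotient.sound h
  · rw [top_le_iff, Submodule.topologicalClosure_eq_top_iff, Submodule.eq_bot_iff]
    intro y hy
    rw [Submodule.mem_orthogonal] at hy
    have hy1 : ∀ σ : Quotient hT.syndromeSetoid, ∀ x, ⟪y, c.translate hT σ.out x⟫_ℂ = 0 := by
      intro σ x
      have h1 : ⟪c.translate hT σ.out x, y⟫_ℂ = 0 := hy _ (Submodule.mem_iSup_of_mem σ ⟨x, rfl⟩)
      rw [← inner_conj_symm, h1, map_zero]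
    refine R.eq_zero_of_forall_inner fun a => ?_
    rw [← inner_conj_symm]
    have key := hT.eq_zero_of_continuous
      ((innerSL ℂ y).toLinearMap ∘ₗ
        (ContinuousLinearMap.apply ℂ R.H R.Ω).toLinearMap ∘ₗ R.π.toLinearMap)
      (by
        change Continuous fun a => ⟪y, R.π a R.Ω⟫_ℂ
        fun_prop) (fun j => ?_) a
    · change ⟪y, R.π a R.Ω⟫_ℂ = 0 at key
      rw [key, map_zero]
    · change ⟪y, R.π (T j) R.Ω⟫_ℂ = 0
      let i := (Quotient.mk hT.syndromeSetoid j).out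
      have hij : star (T i) * T j ∈ B := Quotient.mk_out (s := hT.syndromeSetoid) j
      have h1 : T j = T i * (star (T i) * T j) := by rw [← mul_assoc, hT.mul_star_self, one_mul]
      rw [← c.map_Ω, h1, R.π_mul]
      have h2 := c.map_π ⟨_, hij⟩ R'.Ω
      rw [← h2]
      exact hy1 _ _

/-- The norm of `S V ξ`, expressed by its components in the translates of the corner. -/
theorem isStrongSum_compress (hT : ErrorBasis B U T) (hR : Continuous R.π) (S : R.H →L[ℂ] R.H) :
    IsStrongSum (fun σ : Quotient hT.syndromeSetoid => c.compress (R.π (star (T σ.out)) * S))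
      (c.compress (star S * S)) := by
  have h1 : c.compress (star S * S) = adjoint (S ∘L c.V) ∘L (S ∘L c.V) := by
    rw [adjoint_comp]; rfl
  refine ⟨by rw [h1]; exact isPositive_adjoint_comp_self _, fun ξ => ?_⟩
  have h2 := hasSum_normSq_of_hilbertSum (c.isHilbertSum_translate hT hR)
    (e := fun σ => c.compress (R.π (star (T σ.out)) * S) ξ) (v := S (c.V ξ))
    fun σ ζ => c.inner_translate hT _ S ζ ξ
  convert h2 using 1
  rw [inner_compress, mul_apply_eq_comp, star_eq_adjoint, adjoint_inner_right,
    inner_self_eq_ofReal]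
  rfl

theorem eq_of_inner_translate (hT : ErrorBasis B U T) (hR : Continuous R.π) {u u' : R.H}
    (h : ∀ (σ : Quotient hT.syndromeSetoid) ζ,
      ⟪c.translate hT σ.out ζ, u⟫_ℂ = ⟪c.translate hT σ.out ζ, u'⟫_ℂ) : u = u' := by
  refine (c.isHilbertSum_translate hT hR).linearIsometryEquiv.injective ?_
  ext σ : 2
  refine ext_inner_left ℂ fun ζ => ?_
  rw [← inner_hilbertSum_eq, ← inner_hilbertSum_eq, h]

/-- If the components of a column `d : H' → H` lie in `π'(L)''`, then `d* d` does, as `d`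
intertwines the actions of the commutants `π'(L)' ≃ π(A)'`. -/
theorem adjoint_comp_self_mem_vonNeumann (hT : ErrorBasis B U T) (hR : Continuous R.π)
    (hp : Function.Surjective p)
    {d : R'.H →L[ℂ] R.H} {e : Quotient hT.syndromeSetoid → R'.H →L[ℂ] R'.H}
    (he : ∀ σ, e σ ∈ R'.vonNeumann)
    (hd : ∀ σ ζ ξ, ⟪c.translate hT σ.out ζ, d ξ⟫_ℂ = ⟪ζ, e σ ξ⟫_ℂ) :
    adjoint d ∘L d ∈ R'.vonNeumann := by
  have key : ∀ S ∈ R.commutant, ∀ x, d (c.compress S x) = S (d x) := by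
    intro S hS x
    refine c.eq_of_inner_translate hT hR fun σ ζ => ?_
    have h1 := R'.mem_vonNeumann.1 (he σ)
    rw [hd]
    have h2 : ⟪c.translate hT σ.out ζ, S (d x)⟫_ℂ =
        ⟪c.translate hT σ.out (c.compress (star S) ζ), d x⟫_ℂ := by
      rw [translate_apply, translate_apply, c.V_compress (star_mem hS),
        ← R.mem_commutant.1 (star_mem hS), star_eq_adjoint, adjoint_inner_left]
    rw [h2, hd, compress_star, star_eq_adjoint, adjoint_inner_left,
      h1 _ (c.compress_mem_commutant hp hS)]
  rw [GNSTriple.mem_vonNeumann]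
  intro S₀ hS₀ x
  obtain ⟨S, hS, rfl⟩ := c.exists_compress_eq hT hR hS₀
  refine ext_inner_left ℂ fun y => ?_
  rw [coe_comp, Function.comp_apply, Function.comp_apply, adjoint_inner_right, key S hS,
    ← adjoint_inner_left S, ← star_eq_adjoint, ← key _ (star_mem hS), ← adjoint_inner_right,
    compress_star, star_eq_adjoint, adjoint_inner_left]

end Corner

variable {ω₁ ω₂ : State A} {ω₁' ω₂' : State L}
  {R₁ : GNSTriple.{w₁} ω₁} {R₂ : GNSTriple.{w₂} ω₂}
  {R₁' : GNSTriple.{w₃} ω₁'} {R₂' : GNSTriple.{w₄} ω₂'}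

/-- The map `m ↦ τ (V₁* m V₁)` from `π₁(A)''` to operators on the corner of `R₂`. -/
def compressMap (c₁ : Corner R₁ R₁' p U) (hT : ErrorBasis B U T) (hR₁ : Continuous R₁.π)
    (τ : R₁'.vonNeumann ≃⋆ₐ[ℂ] R₂'.vonNeumann) : R₁.vonNeumann →ₗ[ℂ] (R₂'.H →L[ℂ] R₂'.H) where
  toFun m := (τ (c₁.compressVN hT hR₁ m)).1
  map_add' m m' := by
    rw [map_add (c₁.compressVN hT hR₁), map_add τ]; rfl
  map_smul' z m := by
    rw [map_smul (c₁.compressVN hT hR₁), map_smul τ]; rfl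

section

variable (c₁ : Corner R₁ R₁' p U) (c₂ : Corner R₂ R₂' p U) (hT : ErrorBasis B U T)
  (hR₁ : Continuous R₁.π) (τ : R₁'.vonNeumann ≃⋆ₐ[ℂ] R₂'.vonNeumann)

theorem compressMap_mem (m : R₁.vonNeumann) : compressMap c₁ hT hR₁ τ m ∈ R₂'.vonNeumann :=
  (τ (c₁.compressVN hT hR₁ m)).2

/-- Applying `τ` to the components `V₁* π₁(T_σ)* m V₁` of the column `m V₁` yields the components of
a column `d` of operators into the space of `R₂`, and `d* d` is the image of `V₁* m* m V₁`. The
column is bounded because `τ` is monotone, and the second claim is the normality of `τ`. -/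
theorem exists_column_of_equiv (hR₂ : Continuous R₂.π) (hp : Function.Surjective p)
    (m : R₁.vonNeumann) : ∃ d : R₂'.H →L[ℂ] R₂.H,
    (∀ (σ : Quotient hT.syndromeSetoid) ζ ξ, ⟪c₂.translate hT σ.out ζ, d ξ⟫_ℂ =
      ⟪ζ, compressMap c₁ hT hR₁ τ (R₁.πvN (star (T σ.out)) * m) ξ⟫_ℂ) ∧
    adjoint d ∘L d = compressMap c₁ hT hR₁ τ (star m * m) := by
  have h1 : IsStrongSum (fun σ : Quotient hT.syndromeSetoid =>
      ((c₁.compressVN hT hR₁ (R₁.πvN (star (T σ.out)) * m)) : R₁'.H →L[ℂ] R₁'.H))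
      (c₁.compressVN hT hR₁ (star m * m)) := c₁.isStrongSum_compress hT hR₁ m
  have hW := c₂.isHilbertSum_translate hT hR₂
  have hle := fun s => R₁'.closedUnderSqrt_vonNeumann.sum_map_le
    (StarAlgHomClass.toStarAlgHom τ) s (h1.sum_le s)
  have hpos : (compressMap c₁ hT hR₁ τ (star m * m)).IsPositive :=
    R₁'.closedUnderSqrt_vonNeumann.isPositive_map (StarAlgHomClass.toStarAlgHom τ) h1.isPositive
  obtain ⟨d, hd⟩ := exists_column hW
    (fun σ => compressMap c₁ hT hR₁ τ (R₁.πvN (star (T σ.out)) * m))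
    (Real.sqrt ‖compressMap c₁ hT hR₁ τ (star m * m)‖) (Real.sqrt_nonneg _) (fun s ξ => by
      rw [← re_inner_sum_star_mul_self, mul_pow, Real.sq_sqrt (norm_nonneg _)]
      refine ((le_iff_re_inner (isPositive_sum_star_mul_self s _) hpos).1 (hle s) ξ).trans ?_
      refine (RCLike.re_le_norm _).trans ((norm_inner_le_norm _ _).trans ?_)
      have := (compressMap c₁ hT hR₁ τ (star m * m)).le_opNorm ξ
      nlinarith [norm_nonneg ξ])
  refine ⟨d, hd, ?_⟩
  have hmem := c₂.adjoint_comp_self_mem_vonNeumann hT hR₂ hp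
    (fun σ => compressMap_mem c₁ hT hR₁ τ _) hd
  have h2 : IsStrongSum (fun σ : Quotient hT.syndromeSetoid =>
      ((τ (c₁.compressVN hT hR₁ (R₁.πvN (star (T σ.out)) * m))) : R₂'.H →L[ℂ] R₂'.H))
      (⟨adjoint d ∘L d, hmem⟩ : R₂'.vonNeumann) := by
    refine ⟨isPositive_adjoint_comp_self d, fun ξ => ?_⟩
    have h3 := hasSum_normSq_of_hilbertSum hW (v := d ξ) fun σ ζ => hd σ ζ ξ
    have h5 : RCLike.re ⟪ξ, (adjoint d ∘L d) ξ⟫_ℂ = ‖d ξ‖ ^ 2 := by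
      rw [coe_comp, Function.comp_apply, adjoint_inner_right, inner_self_eq_ofReal]
      rfl
    rw [← h5] at h3
    exact h3
  have h4 := IsStrongSum.map_eq R₁'.closedUnderSqrt_vonNeumann
    R₂'.closedUnderSqrt_vonNeumann τ h1 h2
  exact (congrArg Subtype.val h4).symm

end

end Transport

/-! ### Lifting quasi-equivalences from the corners -/

section Lift

variable {A L : Type*} [Ring A] [StarRing A] [Algebra ℂ A] [StarModule ℂ A]
  [Ring L] [StarRing L] [Algebra ℂ L]
  {B : StarSubalgebra ℂ A} {p : B →ₐ[ℂ] L} {U : Set A}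
  [TopologicalSpace A] {ι : Type*} {T : ι → A}
  {ω₁ ω₂ : State A} {ω₁' ω₂' : State L}
  {R₁ : GNSTriple.{w₁} ω₁} {R₂ : GNSTriple.{w₂} ω₂}
  {R₁' : GNSTriple.{w₃} ω₁'} {R₂' : GNSTriple.{w₄} ω₂'}

section

variable (c₁ : Corner R₁ R₁' p U) (c₂ : Corner R₂ R₂' p U) (hT : ErrorBasis B U T)
  (hR₁ : Continuous R₁.π) (τ : R₁'.vonNeumann ≃⋆ₐ[ℂ] R₂'.vonNeumann)

theorem compressMap_apply (m : R₁.vonNeumann) :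
    compressMap c₁ hT hR₁ τ m = (τ (c₁.compressVN hT hR₁ m)).1 := rfl

theorem continuous_compressMap_π :
    Continuous fun a => compressMap c₁ hT hR₁ τ (R₁.πvN a) := by
  have h1 := c₁.continuous_compress.comp hR₁
  refine continuous_iff_continuousAt.2 fun a => tendsto_iff_norm_sub_tendsto_zero.2
    (squeeze_zero (fun _ => norm_nonneg _) (fun b => ?_)
      (tendsto_iff_norm_sub_tendsto_zero.1 (h1.continuousAt (x := a))))
  rw [← map_sub (compressMap c₁ hT hR₁ τ), compressMap_apply]
  have := R₁'.closedUnderSqrt_vonNeumann.norm_map_le (StarAlgHomClass.toStarAlgHom τ)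
    (c₁.compressVN hT hR₁ (R₁.πvN b - R₁.πvN a))
  refine this.trans (le_of_eq ?_)
  rw [map_sub (c₁.compressVN hT hR₁)]
  rfl

/-- If `τ` maps `π₁'(l)` to `π₂'(l)`, then it maps the compression of `π₁(a)` to that of `π₂(a)`. -/
theorem compress_π_eq_compressMap (hR₂ : Continuous R₂.π)
    (hτ : ∀ l, τ (R₁'.πvN l) = R₂'.πvN l) (a : A) :
    c₂.compress (R₂.π a) = compressMap c₁ hT hR₁ τ (R₁.πvN a) := by
  let f : A →ₗ[ℂ] (R₂'.H →L[ℂ] R₂'.H) :=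
    { toFun := fun a => c₂.compress (R₂.π a) - compressMap c₁ hT hR₁ τ (R₁.πvN a)
      map_add' := fun a b => by
        have h1 : R₁.πvN (a + b) = R₁.πvN a + R₁.πvN b := Subtype.ext (map_add R₁.π a b)
        rw [h1, map_add (compressMap c₁ hT hR₁ τ), map_add, c₂.compress_add]
        abel
      map_smul' := fun z a => by
        have h1 : R₁.πvN (z • a) = z • R₁.πvN a := Subtype.ext (map_smul R₁.π z a)
        rw [h1, map_smul (compressMap c₁ hT hR₁ τ), map_smul, c₂.compress_smul, ← smul_sub]
        rfl }
  refine sub_eq_zero.1 (hT.eq_zero_of_continuous f ?_ (fun j => sub_eq_zero.2 ?_) a)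
  · exact (c₂.continuous_compress.comp hR₂).sub (continuous_compressMap_π c₁ hT hR₁ τ)
  · by_cases h : T j ∈ B
    · have h1 := c₁.compressVN_π hT hR₁ ⟨T j, h⟩
      rw [compressMap_apply, c₂.compress_π_mem ⟨T j, h⟩, h1, hτ]
      rfl
    · obtain ⟨i, hi⟩ := hT.exists_eq_one
      have h1 := c₁.compress_twisted hT (i := i) (j := j) (by rwa [hi, star_one, one_mul])
      have h2 := c₂.compress_twisted hT (i := i) (j := j) (by rwa [hi, star_one, one_mul])
      rw [hi, star_one, one_mul] at h1 h2
      have h3 : c₁.compressVN hT hR₁ (R₁.πvN (T j)) = 0 := Subtype.ext h1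
      rw [compressMap_apply, h2, h3, map_zero]
      rfl

/-- The columns obtained from `m V₁` by applying `τ` to the components are linear in `m`, and their
inner products are given by `τ (V₁* m* m' V₁)`. -/
theorem exists_columns (hR₂ : Continuous R₂.π) (hp : Function.Surjective p) :
    ∃ D : R₁.vonNeumann →ₗ[ℂ] (R₂'.H →ₗ[ℂ] R₂.H),
    (∀ m (σ : Quotient hT.syndromeSetoid) ζ ξ, ⟪c₂.translate hT σ.out ζ, D m ξ⟫_ℂ =
      ⟪ζ, compressMap c₁ hT hR₁ τ (R₁.πvN (star (T σ.out)) * m) ξ⟫_ℂ) ∧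
    ∀ m m' ξ ξ', ⟪D m ξ, D m' ξ'⟫_ℂ = ⟪ξ, compressMap c₁ hT hR₁ τ (star m * m') ξ'⟫_ℂ := by
  choose d hd hdd using exists_column_of_equiv c₁ c₂ hT hR₁ τ hR₂ hp
  let D : R₁.vonNeumann →ₗ[ℂ] (R₂'.H →ₗ[ℂ] R₂.H) :=
    { toFun := fun m => (d m : R₂'.H →ₗ[ℂ] R₂.H)
      map_add' := fun m m' => by
        ext ξ
        refine c₂.eq_of_inner_translate hT hR₂ fun σ ζ => ?_
        change ⟪_, d (m + m') ξ⟫_ℂ = ⟪_, d m ξ + d m' ξ⟫_ℂ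
        rw [inner_add_right, hd, hd, hd, mul_add, map_add (compressMap c₁ hT hR₁ τ), add_apply,
          inner_add_right]
      map_smul' := fun z m => by
        ext ξ
        refine c₂.eq_of_inner_translate hT hR₂ fun σ ζ => ?_
        change ⟪_, d (z • m) ξ⟫_ℂ = ⟪_, z • d m ξ⟫_ℂ
        rw [inner_smul_right, hd, hd, mul_smul_comm, map_smul (compressMap c₁ hT hR₁ τ), smul_apply,
          inner_smul_right] }
  let t : R₁.vonNeumann →ₗ[ℂ] (R₂'.H →ₗ[ℂ] R₂'.H) :=
    { toFun := fun m => (compressMap c₁ hT hR₁ τ m : R₂'.H →ₗ[ℂ] R₂'.H)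
      map_add' := fun m m' => by rw [map_add (compressMap c₁ hT hR₁ τ)]; rfl
      map_smul' := fun z m => by rw [map_smul (compressMap c₁ hT hR₁ τ)]; rfl }
  refine ⟨D, hd, inner_eq_of_forall_self D t fun m ξ => ?_⟩
  change ⟪d m ξ, d m ξ⟫_ℂ = ⟪ξ, compressMap c₁ hT hR₁ τ (star m * m) ξ⟫_ℂ
  rw [← hdd, coe_comp, Function.comp_apply, adjoint_inner_right]

/-- A `*`-homomorphism `Ψ : π₁(A)'' → π₂(A)''` which is `τ` on all matrix entries. It is determined
by `Ψ x (D y ξ) = D (x y) ξ`, where `D y` is the column obtained from `y V₁`. -/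
theorem exists_lift (hR₂ : Continuous R₂.π) (hp : Function.Surjective p)
    (hτ : ∀ l, τ (R₁'.πvN l) = R₂'.πvN l) :
    ∃ Ψ : R₁.vonNeumann →⋆ₐ[ℂ] R₂.vonNeumann, ∀ x a b,
      c₂.compress (R₂.π (star a) * (Ψ x).1 * R₂.π b) =
        (τ (c₁.compressVN hT hR₁ (R₁.πvN (star a) * x * R₁.πvN b))).1 := by
  obtain ⟨D, hD, hDD⟩ := exists_columns c₁ c₂ hT hR₁ τ hR₂ hp
  have hDπ : ∀ a ξ, D (R₁.πvN a) ξ = R₂.π a (c₂.V ξ) := by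
    intro a ξ
    refine c₂.eq_of_inner_translate hT hR₂ fun σ ζ => ?_
    rw [hD, c₂.inner_translate, ← R₁.πvN_mul, ← map_mul,
      compress_π_eq_compressMap c₁ c₂ hT hR₁ τ hR₂ hτ]
  let ρ : R₁.vonNeumann →ₗ[ℂ] (R₁.vonNeumann × R₂'.H → R₂.H) :=
    { toFun := fun x j => D (x * j.1) j.2
      map_add' := fun x y => by
        ext j
        rw [add_mul, map_add D]; rfl
      map_smul' := fun z x => by
        ext j
        rw [smul_mul_assoc, map_smul D]; rfl }
  have hρ : ∀ x j, ρ x j = D (x * j.1) j.2 := fun _ _ => rfl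
  obtain ⟨Ψ, hΨ⟩ := R₁.closedUnderSqrt_vonNeumann.exists_starAlgHom ρ (fun x y j k => by
      rw [hρ, hρ, hρ, hρ, hDD, hDD, one_mul, star_mul, mul_assoc, mul_assoc])
    (R₂.cyclic.mono (by
      rintro _ ⟨a, rfl⟩
      refine Submodule.subset_span ⟨(R₁.πvN a, R₂'.Ω), ?_⟩
      rw [hρ, one_mul, hDπ, c₂.map_Ω]))
  have hΨπ : ∀ x b ξ, Ψ x (R₂.π b (c₂.V ξ)) = D (x * R₁.πvN b) ξ := by
    intro x b ξ
    have := hΨ x 1 (R₁.πvN b, ξ)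
    rw [hρ, hρ, one_mul, mul_one, hDπ] at this
    exact this
  have hrel : ∀ x a b, c₂.compress (R₂.π (star a) * Ψ x * R₂.π b) =
      compressMap c₁ hT hR₁ τ (R₁.πvN (star a) * x * R₁.πvN b) := by
    intro x a b
    ext ξ
    refine ext_inner_left ℂ fun ζ => ?_
    rw [c₂.inner_compress, mul_apply_eq_comp, mul_apply_eq_comp, R₂.inner_π, star_star, hΨπ, ← hDπ,
      hDD, R₁.πvN_star, mul_assoc]
  have hmem : ∀ x, Ψ x ∈ R₂.vonNeumann := by
    intro x
    rw [GNSTriple.mem_vonNeumann]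
    intro S hS v
    have h1 : Ψ x * S = S * Ψ x := by
      refine c₂.eq_of_compress_eq fun a b => ?_
      have hSb : S * R₂.π b = R₂.π b * S := by
        ext v; exact R₂.mem_commutant.1 hS b v
      have hSa : R₂.π (star a) * S = S * R₂.π (star a) := by
        ext v; exact (R₂.mem_commutant.1 hS _ v).symm
      have e1 : R₂.π (star a) * (Ψ x * S) * R₂.π b = R₂.π (star a) * Ψ x * R₂.π b * S := by
        simp only [mul_assoc, hSb]
      have e2 : R₂.π (star a) * (S * Ψ x) * R₂.π b = S * (R₂.π (star a) * Ψ x * R₂.π b) := by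
        rw [← mul_assoc, hSa]; simp only [mul_assoc]
      rw [e1, e2, c₂.compress_mul_of_commutant _ hS, c₂.compress_mul_of_commutant' hS, hrel]
      ext v
      exact R₂'.mem_vonNeumann.1 (compressMap_mem c₁ hT hR₁ τ _) _
        (c₂.compress_mem_commutant hp hS) v
    exact congrArg (fun X : R₂.H →L[ℂ] R₂.H => X v) h1
  exact ⟨Ψ.codRestrict R₂.vonNeumann hmem, fun x a b => hrel x a b⟩

end

/-- Representations with quasi-equivalent corners are quasi-equivalent. -/
theorem QuasiEquivalent.of_compress (c₁ : Corner R₁ R₁' p U) (c₂ : Corner R₂ R₂' p U)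
    (hT : ErrorBasis B U T) (hR₁ : Continuous R₁.π) (hR₂ : Continuous R₂.π)
    (hp : Function.Surjective p) (h : QuasiEquivalent R₁' R₂') : QuasiEquivalent R₁ R₂ := by
  obtain ⟨τ, hτ⟩ := h
  change ∀ l, τ (R₁'.πvN l) = R₂'.πvN l at hτ
  have hτ' : ∀ l, τ.symm (R₂'.πvN l) = R₁'.πvN l := fun l => by
    rw [← hτ, τ.symm_apply_apply]
  obtain ⟨Ψ, hΨ⟩ := exists_lift c₁ c₂ hT hR₁ τ hR₂ hp hτ
  obtain ⟨Ψ', hΨ'⟩ := exists_lift c₂ c₁ hT hR₂ τ.symm hR₁ hp hτ'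
  have hl : ∀ x, Ψ' (Ψ x) = x := by
    intro x
    refine Subtype.ext (c₁.eq_of_compress_eq fun a b => ?_)
    have h1 : c₂.compressVN hT hR₂ (R₂.πvN (star a) * Ψ x * R₂.πvN b) =
        τ (c₁.compressVN hT hR₁ (R₁.πvN (star a) * x * R₁.πvN b)) := Subtype.ext (hΨ x a b)
    rw [hΨ', h1, τ.symm_apply_apply]
    rfl
  have hr : ∀ x, Ψ (Ψ' x) = x := by
    intro x
    refine Subtype.ext (c₂.eq_of_compress_eq fun a b => ?_)
    have h1 : c₁.compressVN hT hR₁ (R₁.πvN (star a) * Ψ' x * R₁.πvN b) =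
        τ.symm (c₂.compressVN hT hR₂ (R₂.πvN (star a) * x * R₂.πvN b)) := Subtype.ext (hΨ' x a b)
    rw [hΨ, h1, τ.apply_symm_apply]
    rfl
  refine ⟨StarAlgEquiv.ofBijective Ψ ⟨Function.LeftInverse.injective hl,
    Function.RightInverse.surjective hr⟩, fun a => ?_⟩
  refine Subtype.ext (c₂.eq_of_compress_eq fun b b' => ?_)
  change c₂.compress (R₂.π (star b) * (Ψ (R₁.πvN a)).1 * R₂.π b') =
    c₂.compress (R₂.π (star b) * R₂.π a * R₂.π b')
  rw [hΨ, ← map_mul, ← map_mul, compress_π_eq_compressMap c₁ c₂ hT hR₁ τ hR₂ hτ, compressMap_apply,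
    R₁.πvN_mul, R₁.πvN_mul]

end Lift

/-! ### The Pauli operators span the quasi-local algebra -/

section Pauli

variable {S : Type u} {G : Type v} [AddCommGroup G]

theorem Dual.map_add (χ : Dual G) (g g' : G) : χ (g + g') = χ g * χ g' :=
  AddChar.map_add_eq_mul (χ : AddChar G ℂ) g g'

theorem Dual.map_zero (χ : Dual G) : χ 0 = 1 := AddChar.map_zero_eq_one (χ : AddChar G ℂ)

/-- The value `∏_s b_s(h_s)` of a finitely supported family of characters on a configuration. -/
def pairing (b : S →₀ Dual G) (h : S → G) : ℂ := b.prod fun s χ => χ (h s)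

theorem pairing_add_left (b b' : S →₀ Dual G) (h : S → G) :
    pairing (b + b') h = pairing b h * pairing b' h :=
  Finsupp.prod_add_index' (fun _ => Dual.zero_apply _) fun _ _ _ => Dual.add_apply _ _ _

theorem pairing_add_right (b : S →₀ Dual G) (h h' : S → G) :
    pairing b (h + h') = pairing b h * pairing b h' := by
  simp only [pairing, Finsupp.prod, Pi.add_apply, Dual.map_add, Finset.prod_mul_distrib]

theorem pairing_zero_left (h : S → G) : pairing (0 : S →₀ Dual G) h = 1 := Finsupp.prod_zero_index

theorem pairing_zero_right (b : S →₀ Dual G) : pairing b (0 : S → G) = 1 := by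
  simp [pairing, Finsupp.prod, Dual.map_zero]

theorem pairing_neg_mul (b : S →₀ Dual G) (h : S → G) : pairing (-b) h * pairing b h = 1 := by
  rw [← pairing_add_left, neg_add_cancel, pairing_zero_left]

variable [Fintype G]

theorem localFun_siteTensor_siteX (a : S →₀ G) (ψ : (S → G) → ℂ) (h : S → G) :
    localFun a.support (siteTensor a.support fun s => siteX (a s)) ψ h = ψ (h - a) := by
  classical
  unfold localFun
  rw [Finset.sum_eq_single (fun s : a.support => h s - a s)]
  · have h1 : siteTensor a.support (fun s => siteX (a s)) (restr a.support h)
        (fun s => h s - a s) = 1 := by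
      refine Finset.prod_eq_one fun s _ => ?_
      simp [siteX, restr]
    have h2 : splice a.support (fun s : a.support => h s - a s) h = h - a := by
      funext s
      by_cases hs : s ∈ a.support
      · simp [splice, hs]
      · simp only [splice, hs, dite_false, Pi.sub_apply, Finsupp.notMem_support_iff.1 hs, sub_zero]
    rw [h1, h2, one_mul]
  · intro k _ hk
    obtain ⟨s, hs⟩ := Function.ne_iff.1 hk
    have h1 : siteTensor a.support (fun s => siteX (a s)) (restr a.support h) k = 0 := by
      refine Finset.prod_eq_zero (Finset.mem_univ s) ?_
      exact if_neg fun h2 : h s = a s + k s => hs (by rw [h2]; abel)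
    rw [h1, zero_mul]
  · simp

theorem localFun_siteTensor_siteZ (b : S →₀ Dual G) (ψ : (S → G) → ℂ) (h : S → G) :
    localFun b.support (siteTensor b.support fun s => siteZ (b s)) ψ h = pairing b h * ψ h := by
  classical
  unfold localFun
  rw [Finset.sum_eq_single (restr b.support h)]
  · rw [splice_restr]
    congr 1
    simp only [siteTensor, siteZ, Matrix.diagonal_apply_eq, restr, pairing, Finsupp.prod]
    exact Finset.prod_coe_sort b.support fun s => b s (h s)
  · intro k _ hk
    obtain ⟨s, hs⟩ := Function.ne_iff.1 hk
    have h1 : siteTensor b.support (fun s => siteZ (b s)) (restr b.support h) k = 0 := by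
      refine Finset.prod_eq_zero (Finset.mem_univ s) ?_
      exact Matrix.diagonal_apply_ne _ (Ne.symm hs)
    rw [h1, zero_mul]
  · simp

theorem pauliX_apply (a : S →₀ G) (ψ : ConfigSpace S G) (h : S → G) :
    (pauliX a : ConfigSpace S G →L[ℂ] ConfigSpace S G) ψ h = ψ (h - a) :=
  localFun_siteTensor_siteX a ψ h

theorem pauliZ_apply (b : S →₀ Dual G) (ψ : ConfigSpace S G) (h : S → G) :
    (pauliZ b : ConfigSpace S G →L[ℂ] ConfigSpace S G) ψ h = pairing b h * ψ h :=
  localFun_siteTensor_siteZ b ψ h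

theorem quasiLocal_ext {A A' : quasiLocalAlgebra S G}
    (h : ∀ (ψ : ConfigSpace S G) k, (A : ConfigSpace S G →L[ℂ] ConfigSpace S G) ψ k =
      (A' : ConfigSpace S G →L[ℂ] ConfigSpace S G) ψ k) : A = A' :=
  Subtype.ext (ContinuousLinearMap.ext fun ψ => lp.ext (funext fun k => h ψ k))

/-- The Pauli operator `X^a Z^b`, for a pair `(a, b)`. -/
def pauli (i : (S →₀ G) × (S →₀ Dual G)) : quasiLocalAlgebra S G := pauliX i.1 * pauliZ i.2

theorem pauli_apply (i : (S →₀ G) × (S →₀ Dual G)) (ψ : ConfigSpace S G) (h : S → G) :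
    (pauli i : ConfigSpace S G →L[ℂ] ConfigSpace S G) ψ h =
      pairing i.2 (h - i.1) * ψ (h - i.1) := by
  change (pauliX i.1 : ConfigSpace S G →L[ℂ] ConfigSpace S G)
    ((pauliZ i.2 : ConfigSpace S G →L[ℂ] ConfigSpace S G) ψ) h = _
  rw [pauliX_apply, pauliZ_apply]

/-- The product of two Pauli operators is a Pauli operator up to a phase. -/
theorem pauli_mul (i j : (S →₀ G) × (S →₀ Dual G)) :
    pauli i * pauli j = pairing i.2 j.1 • pauli (i + j) := by
  refine quasiLocal_ext fun ψ h => ?_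
  change (pauli i : ConfigSpace S G →L[ℂ] ConfigSpace S G)
    ((pauli j : ConfigSpace S G →L[ℂ] ConfigSpace S G) ψ) h =
    pairing i.2 j.1 * (pauli (i + j) : ConfigSpace S G →L[ℂ] ConfigSpace S G) ψ h
  rw [pauli_apply, pauli_apply, pauli_apply]
  have h1 : h - ⇑(i + j).1 = h - i.1 - j.1 := by
    rw [Prod.fst_add, Finsupp.coe_add]; abel
  have h2 : pairing i.2 (h - i.1) = pairing i.2 (h - i.1 - j.1) * pairing i.2 j.1 := by
    rw [← pairing_add_right, sub_add_cancel]
  rw [h1, h2, Prod.snd_add, pairing_add_left]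
  ring

theorem pauli_zero : pauli (0 : (S →₀ G) × (S →₀ Dual G)) = 1 := by
  refine quasiLocal_ext fun ψ h => ?_
  rw [pauli_apply]
  simp [pairing_zero_left]

theorem star_siteTensor (Λ : Finset S) (M : S → Matrix G G ℂ) :
    star (siteTensor Λ M) = siteTensor Λ fun s => star (M s) := by
  ext j k
  simp [siteTensor, Matrix.star_apply]

theorem star_siteX (g : G) : star (siteX g) = siteX (-g) := by
  classical
  ext j k
  have : k = g + j ↔ j = -g + k := by rw [eq_neg_add_iff_add_eq, eq_comm]
  rw [Matrix.star_apply]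
  by_cases h : k = g + j
  · rw [siteX, siteX, if_pos h, if_pos (this.1 h), star_one]
  · rw [siteX, siteX, if_neg h, if_neg (mt this.2 h), star_zero]

theorem star_siteZ (χ : Dual G) : star (siteZ χ) = siteZ (-χ) := by
  classical
  rw [siteZ, siteZ, Matrix.star_eq_conjTranspose, Matrix.diagonal_conjTranspose]
  congr 1
  funext g
  exact ((AddChar.neg_apply (χ : AddChar G ℂ) g).trans
    (AddChar.map_neg_eq_conj (χ : AddChar G ℂ) g)).symm

theorem star_pauliX (a : S →₀ G) : star (pauliX a) = pauliX (-a) := by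
  refine Subtype.ext ?_
  change star (localOp a.support (siteTensor a.support fun s => siteX (a s))) =
    localOp (-a).support (siteTensor (-a).support fun s => siteX ((-a) s))
  rw [← map_star, star_siteTensor]
  simp only [star_siteX]
  exact congrArg (fun Λ => localOp Λ (siteTensor Λ fun s => siteX (-a s))) a.support_neg.symm

theorem star_pauliZ (b : S →₀ Dual G) : star (pauliZ b) = pauliZ (-b) := by
  refine Subtype.ext ?_
  change star (localOp b.support (siteTensor b.support fun s => siteZ (b s))) =
    localOp (-b).support (siteTensor (-b).support fun s => siteZ ((-b) s))
  rw [← map_star, star_siteTensor]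
  simp only [star_siteZ]
  exact congrArg (fun Λ => localOp Λ (siteTensor Λ fun s => siteZ (-b s))) b.support_neg.symm

theorem pauliX_zero : pauliX (0 : S →₀ G) = 1 := by
  refine quasiLocal_ext fun ψ h => ?_
  rw [pauliX_apply]
  simp

theorem pauliZ_zero : pauliZ (0 : S →₀ Dual G) = 1 := by
  refine quasiLocal_ext fun ψ h => ?_
  rw [pauliZ_apply, pairing_zero_left, one_mul]
  rfl

theorem star_pauli (i : (S →₀ G) × (S →₀ Dual G)) :
    star (pauli i) = pairing i.2 i.1 • pauli (-i) := by
  rw [pauli, star_mul, star_pauliX, star_pauliZ]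
  have h1 : pauliZ (-i.2) = pauli ((0, -i.2) : (S →₀ G) × (S →₀ Dual G)) := by
    rw [pauli, pauliX_zero, one_mul]
  have h2 : pauliX (-i.1) = pauli ((-i.1, 0) : (S →₀ G) × (S →₀ Dual G)) := by
    rw [pauli, pauliZ_zero, mul_one]
  rw [h1, h2, pauli_mul]
  have h3 : pairing (-i.2) ⇑(-i.1) = pairing i.2 i.1 := by
    have e1 := pairing_neg_mul i.2 (⇑(-i.1))
    have e2 := pairing_add_right i.2 i.1 (⇑(-i.1))
    rw [Finsupp.coe_neg, add_neg_cancel, pairing_zero_right] at e2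
    rw [Finsupp.coe_neg] at e1 ⊢
    calc pairing (-i.2) (-⇑i.1)
        = pairing (-i.2) (-⇑i.1) * (pairing i.2 i.1 * pairing i.2 (-⇑i.1)) := by rw [← e2, mul_one]
      _ = pairing i.2 i.1 * (pairing (-i.2) (-⇑i.1) * pairing i.2 (-⇑i.1)) := by ring
      _ = _ := by rw [e1, mul_one]
  rw [h3]
  congr 2
  ext s <;> simp

theorem star_pauli_mul_self (i : (S →₀ G) × (S →₀ Dual G)) : star (pauli i) * pauli i = 1 := by
  rw [star_pauli, smul_mul_assoc, pauli_mul, neg_add_cancel, pauli_zero, smul_smul, Prod.snd_neg,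
    mul_comm, pairing_neg_mul, one_smul]

theorem pauli_mul_star_self (i : (S →₀ G) × (S →₀ Dual G)) : pauli i * star (pauli i) = 1 := by
  rw [star_pauli, mul_smul_comm, pauli_mul, add_neg_cancel, pauli_zero, smul_smul, Prod.fst_neg,
    ← pairing_add_right, Finsupp.coe_neg, add_neg_cancel, pairing_zero_right, one_smul]

theorem pauli_mul_comm (i j : (S →₀ G) × (S →₀ Dual G)) :
    pauli i * pauli j = (pairing i.2 j.1 * pairing (-j.2) i.1) • (pauli j * pauli i) := by
  rw [pauli_mul, pauli_mul j, smul_smul, mul_assoc, pairing_neg_mul, mul_one, add_comm j]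

section Span

open Classical in
/-- The extension by zero of a family indexed by a finite set. -/
def extendZero {M : Type*} [Zero M] (Λ : Finset S) (f : Λ → M) : S →₀ M :=
  Finsupp.onFinset Λ (fun s => if hs : s ∈ Λ then f ⟨s, hs⟩ else 0) fun s hs => by
    by_contra h
    simp [h] at hs

theorem extendZero_of_mem {M : Type*} [Zero M] {Λ : Finset S} (f : Λ → M) (s : Λ) :
    extendZero Λ f s = f s := by simp [extendZero]

theorem extendZero_of_notMem {M : Type*} [Zero M] {Λ : Finset S} (f : Λ → M) {s : S}
    (hs : s ∉ Λ) : extendZero Λ f s = 0 := by simp [extendZero, hs]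

theorem pairing_extendZero (Λ : Finset S) (f : Λ → Dual G) (h : S → G) :
    pairing (extendZero Λ f) h = ∏ s : Λ, f s (h s) := by
  have hsub : (extendZero Λ f).support ⊆ Λ := Finsupp.support_onFinset_subset
  rw [pairing, Finsupp.prod_of_support_subset _ hsub (fun s χ => χ (h s))
    (fun _ _ => Dual.zero_apply _),
    ← Finset.prod_coe_sort]
  exact Finset.prod_congr rfl fun s _ => by rw [extendZero_of_mem]

instance : Fintype (Dual G) := inferInstanceAs (Fintype (AddChar G ℂ))

open Classical in
theorem Dual.sum_apply (g : G) : ∑ χ : Dual G, χ g = if g = 0 then (Fintype.card G : ℂ) else 0 := by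
  exact AddChar.sum_apply_eq_ite (α := G) g

open Classical in
/-- The projection onto the configurations which agree with `k` on `Λ`, written as a Fourier sum of
the operators `Z^b` (`configProj_apply`). -/
def configProj (Λ : Finset S) (k : Λ → G) : quasiLocalAlgebra S G :=
  ∑ f : Λ → Dual G, (∏ s, (Fintype.card G : ℂ)⁻¹ * f s (-k s)) • pauliZ (extendZero Λ f)

open Classical in
theorem configProj_apply (Λ : Finset S) (k : Λ → G) (ψ : ConfigSpace S G) (h : S → G) :
    (configProj Λ k : ConfigSpace S G →L[ℂ] ConfigSpace S G) ψ h =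
      if restr Λ h = k then ψ h else 0 := by
  have h1 : (configProj Λ k : ConfigSpace S G →L[ℂ] ConfigSpace S G) ψ h =
      ∑ f : Λ → Dual G, (∏ s, (Fintype.card G : ℂ)⁻¹ * f s (-k s)) *
        (pairing (extendZero Λ f) h * ψ h) := by
    rw [configProj, AddSubmonoidClass.coe_finsetSum, sum_apply,
      lp.coeFn_sum, Finset.sum_apply]
    refine Finset.sum_congr rfl fun f _ => ?_
    rw [← pauliZ_apply]
    rfl
  have h2 : ∀ f : Λ → Dual G, (∏ s, (Fintype.card G : ℂ)⁻¹ * f s (-k s)) *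
      (pairing (extendZero Λ f) h * ψ h) =
      (∏ s, (Fintype.card G : ℂ)⁻¹ * f s (h s - k s)) * ψ h := by
    intro f
    rw [pairing_extendZero, ← mul_assoc, ← Finset.prod_mul_distrib]
    congr 1
    refine Finset.prod_congr rfl fun s _ => ?_
    rw [sub_eq_neg_add, Dual.map_add, mul_assoc]
  have h3 := Finset.prod_univ_sum (fun _ : Λ => (Finset.univ : Finset (Dual G)))
    (fun s χ => (Fintype.card G : ℂ)⁻¹ * χ (h s - k s))
  rw [Fintype.piFinset_univ] at h3
  simp only [← Finset.mul_sum, Dual.sum_apply] at h3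
  rw [h1, Finset.sum_congr rfl fun f _ => h2 f, ← Finset.sum_mul, ← h3]
  by_cases hk : restr Λ h = k
  · rw [if_pos hk, Finset.prod_eq_one, one_mul]
    intro s _
    have : h s - k s = 0 := sub_eq_zero.2 (congrFun hk s)
    rw [if_pos this, inv_mul_cancel₀]
    exact Nat.cast_ne_zero.2 Fintype.card_ne_zero
  · obtain ⟨s, hs⟩ := Function.ne_iff.1 hk
    have : ¬ h s - k s = 0 := fun h0 => hs (sub_eq_zero.1 h0)
    rw [if_neg hk, Finset.prod_eq_zero (Finset.mem_univ s), zero_mul]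
    rw [if_neg this, mul_zero]

open Classical in
/-- The matrix unit `|j⟩⟨k|` on the sites in `Λ` is the shift by `j - k` after the projection onto
`k`. -/
theorem localOp_eq_sum (Λ : Finset S) (A : Matrix (Λ → G) (Λ → G) ℂ) :
    (⟨localOp Λ A, localOp_mem Λ A⟩ : quasiLocalAlgebra S G) =
      ∑ j, ∑ k, A j k • (pauliX (extendZero Λ (j - k)) * configProj Λ k) := by
  refine quasiLocal_ext fun ψ h => ?_
  have h1 : ((∑ j, ∑ k, A j k • (pauliX (extendZero Λ (j - k)) * configProj Λ k) :
      quasiLocalAlgebra S G) : ConfigSpace S G →L[ℂ] ConfigSpace S G) ψ h =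
      ∑ j, ∑ k, A j k * if restr Λ (h - ⇑(extendZero Λ (j - k))) = k then
        ψ (h - ⇑(extendZero Λ (j - k))) else 0 := by
    let ev : quasiLocalAlgebra S G →ₗ[ℂ] ℂ :=
      { toFun := fun A => (A : ConfigSpace S G →L[ℂ] ConfigSpace S G) ψ h
        map_add' := fun _ _ => rfl
        map_smul' := fun _ _ => rfl }
    change ev _ = _
    rw [map_sum]
    refine Finset.sum_congr rfl fun j _ => ?_
    rw [map_sum]
    refine Finset.sum_congr rfl fun k _ => ?_
    rw [← configProj_apply, ← pauliX_apply]
    rfl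
  rw [h1]
  have h2 : ∀ j k : Λ → G, restr Λ (h - ⇑(extendZero Λ (j - k))) = k ↔ j = restr Λ h := by
    intro j k
    rw [funext_iff, funext_iff]
    refine forall_congr' fun s => ?_
    simp only [restr, Pi.sub_apply, extendZero_of_mem]
    constructor
    · intro h3
      rw [sub_eq_iff_eq_add] at h3
      rw [h3]; abel
    · intro h3
      rw [h3]; abel
  simp only [h2]
  rw [Finset.sum_eq_single (restr Λ h)]
  · change localFun Λ A ψ h = _
    refine Finset.sum_congr rfl fun k _ => ?_
    rw [if_pos rfl]
    congr 1
    refine congrArg (fun x => ψ x) (funext fun s => ?_)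
    by_cases hs : s ∈ Λ
    · have := extendZero_of_mem (restr Λ h - k) ⟨s, hs⟩
      simp only at this
      simp [splice, hs, this, restr]
    · simp [splice, hs, extendZero_of_notMem]
  · intro j _ hj
    simp [hj]
  · simp

variable (S G) in
/-- The linear span of the Pauli operators. -/
abbrev pauliSpan : Submodule ℂ (quasiLocalAlgebra S G) := Submodule.span ℂ (Set.range pauli)

theorem pauliX_mul_mem_span {A : quasiLocalAlgebra S G} (a : S →₀ G)
    (hA : A ∈ pauliSpan S G) :
    pauliX a * A ∈ pauliSpan S G := by
  have h1 : pauliX a = pauli ((a, 0) : (S →₀ G) × (S →₀ Dual G)) := by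
    rw [pauli, pauliZ_zero, mul_one]
  induction hA using Submodule.span_induction with
  | mem x hx =>
    obtain ⟨i, rfl⟩ := hx
    rw [h1, pauli_mul]
    exact Submodule.smul_mem _ _ (Submodule.subset_span ⟨_, rfl⟩)
  | zero => rw [mul_zero]; exact zero_mem _
  | add x y _ _ hx hy => rw [mul_add]; exact add_mem hx hy
  | smul z x _ hx => rw [mul_smul_comm]; exact Submodule.smul_mem _ _ hx

theorem localOp_mem_span (Λ : Finset S) (A : Matrix (Λ → G) (Λ → G) ℂ) :
    (⟨localOp Λ A, localOp_mem Λ A⟩ : quasiLocalAlgebra S G) ∈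
      pauliSpan S G := by
  classical
  rw [localOp_eq_sum]
  refine sum_mem fun j _ => sum_mem fun k _ => Submodule.smul_mem _ _ (pauliX_mul_mem_span _ ?_)
  refine sum_mem fun f _ => Submodule.smul_mem _ _ (Submodule.subset_span ⟨(0, extendZero Λ f), ?_⟩)
  rw [pauli, pauliX_zero, one_mul]

variable (S G) in
/-- The linear span of the Pauli operators, as a `*`-algebra. -/
def pauliAlgebra : StarSubalgebra ℂ (quasiLocalAlgebra S G) where
  carrier := pauliSpan S G
  zero_mem' := zero_mem (pauliSpan S G)
  one_mem' := Submodule.subset_span ⟨0, pauli_zero⟩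
  add_mem' := (pauliSpan S G).add_mem
  mul_mem' {A A'} hA hA' := by
    have h1 : A * A' ∈ pauliSpan S G * pauliSpan S G := Submodule.mul_mem_mul hA hA'
    rw [Submodule.span_mul_span] at h1
    refine Submodule.span_le.2 ?_ h1
    rintro _ ⟨_, ⟨i, rfl⟩, _, ⟨j, rfl⟩, rfl⟩
    change pauli i * pauli j ∈ pauliSpan S G
    rw [pauli_mul]
    exact Submodule.smul_mem _ _ (Submodule.subset_span ⟨_, rfl⟩)
  algebraMap_mem' z := by
    change _ ∈ pauliSpan S G
    rw [Algebra.algebraMap_eq_smul_one, ← pauli_zero]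
    exact Submodule.smul_mem _ _ (Submodule.subset_span ⟨_, rfl⟩)
  star_mem' {A} hA := by
    change A ∈ pauliSpan S G at hA
    change star A ∈ pauliSpan S G
    induction hA using Submodule.span_induction with
    | mem x hx =>
      obtain ⟨i, rfl⟩ := hx
      rw [star_pauli]
      exact Submodule.smul_mem _ _ (Submodule.subset_span ⟨_, rfl⟩)
    | zero => rw [star_zero]; exact zero_mem _
    | add x y _ _ hx hy => rw [star_add]; exact add_mem hx hy
    | smul z x _ hx => rw [star_smul]; exact Submodule.smul_mem _ _ hx

theorem dense_span_pauli : Dense (pauliSpan S G : Set (quasiLocalAlgebra S G)) := by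
  rw [Subtype.dense_iff]
  have h1 : StarAlgebra.adjoin ℂ (⋃ Λ : Finset S, Set.range (localOp (G := G) Λ)) ≤
      (pauliAlgebra S G).map (quasiLocalAlgebra S G).subtype := by
    refine StarAlgebra.adjoin_le ?_
    rintro _ hA
    obtain ⟨Λ, A, rfl⟩ := Set.mem_iUnion.1 hA
    exact ⟨⟨localOp Λ A, localOp_mem Λ A⟩, localOp_mem_span Λ A, rfl⟩
  intro A hA
  exact closure_mono (show (_ : Set (ConfigSpace S G →L[ℂ] ConfigSpace S G)) ⊆ _ from h1) hA

end Span

end Pauli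

/-! ### States with value one on the stabilizers -/

section Corner

variable {A L : Type*} [Ring A] [StarRing A] [Algebra ℂ A] [StarModule ℂ A]
  [Ring L] [StarRing L] [Algebra ℂ L] [TopologicalSpace A]
  {B : StarSubalgebra ℂ A} {p : B →ₐ[ℂ] L} {U : Set A} {ι : Type*} {T : ι → A}

theorem ErrorBasis.isIrreducible_iff_and_centerEquiv {ω : State A} {ω' : State L}
    (hT : ErrorBasis B U T) (R : GNSTriple.{w} ω) (R' : GNSTriple.{w'} ω')
    (hR : Continuous R.π) (hp : Function.Surjective p) (hps : ∀ b, p (star b) = star (p b))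
    (hω : ∀ u ∈ U, ω u = 1) (hωp : ∀ b : B, ω (b : A) = ω' (p b)) :
    (R.IsIrreducible ↔ R'.IsIrreducible) ∧ Nonempty (R.center ≃⋆ₐ[ℂ] R'.center) ∧
      (R.IsFactor ↔ R'.IsFactor) := by
  obtain ⟨c⟩ := hT.exists_corner R R' hR p hp hps hω hωp
  have e := GNSTriple.centerEquiv (c.commutantEquiv hT hR hp)
  exact ⟨⟨c.isIrreducible_compressed hT hR, c.isIrreducible_of_compressed hp⟩, ⟨e⟩,
    ⟨GNSTriple.IsFactor.of_centerEquiv e, GNSTriple.IsFactor.of_centerEquiv e.symm⟩⟩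

theorem ErrorBasis.quasiEquivalent_iff {ω₁ ω₂ : State A} {ω₁' ω₂' : State L}
    (hT : ErrorBasis B U T) (R₁ : GNSTriple.{w₁} ω₁) (R₂ : GNSTriple.{w₂} ω₂)
    (R₁' : GNSTriple.{w₃} ω₁') (R₂' : GNSTriple.{w₄} ω₂')
    (hR₁ : Continuous R₁.π) (hR₂ : Continuous R₂.π) (hp : Function.Surjective p)
    (hps : ∀ b, p (star b) = star (p b)) (hω₁ : ∀ u ∈ U, ω₁ u = 1) (hω₂ : ∀ u ∈ U, ω₂ u = 1)
    (hωp₁ : ∀ b : B, ω₁ (b : A) = ω₁' (p b)) (hωp₂ : ∀ b : B, ω₂ (b : A) = ω₂' (p b)) :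
    QuasiEquivalent R₁ R₂ ↔ QuasiEquivalent R₁' R₂' := by
  obtain ⟨c₁⟩ := hT.exists_corner R₁ R₁' hR₁ p hp hps hω₁ hωp₁
  obtain ⟨c₂⟩ := hT.exists_corner R₂ R₂' hR₂ p hp hps hω₂ hωp₂
  exact ⟨QuasiEquivalent.compress c₁ c₂ hp hT hR₁ hR₂,
    QuasiEquivalent.of_compress c₁ c₂ hT hR₁ hR₂ hp⟩

end Corner

/-! ### The Kitaev model -/

section Model

theorem isClosed_quasiLocalAlgebra (S : Type u) (G : Type v) [Fintype G] :
    IsClosed (quasiLocalAlgebra S G : Set (ConfigSpace S G →L[ℂ] ConfigSpace S G)) :=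
  StarSubalgebra.isClosed_topologicalClosure _

/-- The quasi-local algebra is a C*-algebra, so its representations are contractive. -/
theorem GNSTriple.continuous_π {S : Type u} {G : Type v} [Fintype G]
    {ω : State (quasiLocalAlgebra S G)} (R : GNSTriple.{w} ω) : Continuous R.π := by
  let _ : CStarAlgebra (quasiLocalAlgebra S G) :=
    StarSubalgebra.cstarAlgebra (quasiLocalAlgebra S G)
      (h_closed := isClosed_quasiLocalAlgebra S G)
  exact AddMonoidHomClass.continuous_of_bound R.π 1 fun a => by
    rw [one_mul]
    exact NonUnitalStarAlgHom.norm_apply_le R.π a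

variable (E : Type u) [TopologicalSpace E] [T2Space E] [CWComplex (Set.univ : Set E)]
  [LocallyFiniteIncidence E] (G : Type v) [AddCommGroup G] [Fintype G] (n : ℕ)

/-- The stabilizers: the operators `X^s Z^r` with `s` a coboundary and `r` a boundary. -/
def stabilizers : Set (Observables E G n) :=
  {A | ∃ s ∈ coboundaries E G n, ∃ r ∈ boundaries E G n, A = pauliX s * pauliZ r}

variable {E G n}

theorem mul_comm_of_mem_stabilizerCommutant {A : Observables E G n}
    (hA : A ∈ stabilizerCommutant E G n) {u : Observables E G n} (hu : u ∈ stabilizers E G n) :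
    u * A = A * u :=
  ((StarSubalgebra.mem_centralizer_iff ℂ).1 hA u
    (Submodule.le_topologicalClosure _ (Submodule.subset_span hu))).1

theorem mem_stabilizerCommutant_of_unitary {A : Observables E G n} (h1 : star A * A = 1)
    (h2 : A * star A = 1) (h : ∀ u ∈ stabilizers E G n, u * A = A * u) :
    A ∈ stabilizerCommutant E G n := by
  have hall : ∀ g ∈ stabilizerAlgebra E G n, g * A = A * g := by
    intro g hg
    have hc : IsClosed {g : Observables E G n | g * A = A * g} :=
      isClosed_eq (continuous_id.mul continuous_const) (continuous_const.mul continuous_id)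
    refine closure_minimal (fun g hg => ?_) hc hg
    induction hg using Submodule.span_induction with
    | mem u hu => exact h u hu
    | zero => exact (zero_mul A).trans (mul_zero A).symm
    | add x y _ _ hx hy =>
      change (x + y) * A = A * (x + y)
      rw [add_mul, mul_add, show x * A = A * x from hx, show y * A = A * y from hy]
    | smul z x _ hx =>
      change (z • x) * A = A * (z • x)
      rw [smul_mul_assoc, mul_smul_comm, show x * A = A * x from hx]
  refine (StarSubalgebra.mem_centralizer_iff ℂ).2 fun g hg => ⟨hall g hg, ?_⟩
  have h3 : star A * g = g * star A := by
    calc star A * g = star A * (g * A) * star A := by rw [mul_assoc, mul_assoc, h2, mul_one]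
      _ = star A * A * (g * star A) := by rw [hall g hg]; simp only [mul_assoc]
      _ = g * star A := by rw [h1, one_mul]
  have h4 := congrArg star h3
  rwa [star_mul, star_mul, star_star] at h4

variable (E G n)

/-- The Pauli operators are an error basis for the stabilizers and their commutant, as any two of
them commute up to a phase. -/
theorem errorBasis_pauli : ErrorBasis (stabilizerCommutant E G n) (stabilizers E G n)
    (pauli : (Cell E n →₀ G) × (Cell E n →₀ Dual G) → Observables E G n) where
  star_mul_stabilizer := by
    rintro _ ⟨s, -, r, -, rfl⟩
    exact star_pauli_mul_self (s, r)
  star_mul_self := star_pauli_mul_self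
  mul_star_self := pauli_mul_star_self
  exists_eq_one := ⟨0, pauli_zero⟩
  dense_span := dense_span_pauli
  commute := fun b hb u hu => mul_comm_of_mem_stabilizerCommutant hb hu
  mem_or_twisted := by
    intro i j
    have hphase : ∀ u ∈ stabilizers E G n, ∃ θ : ℂ,
        u * (star (pauli i) * pauli j) = θ • (star (pauli i) * pauli j * u) := by
      rintro _ ⟨s, -, r, -, rfl⟩
      change ∃ θ : ℂ, pauli (s, r) * _ = θ • (_ * pauli (s, r))
      rw [star_pauli, smul_mul_assoc, pauli_mul, smul_smul]
      refine ⟨pairing (s, r).2 (-i + j).1 * pairing (-(-i + j).2) (s, r).1, ?_⟩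
      rw [mul_smul_comm, pauli_mul_comm (s, r), smul_mul_assoc, smul_comm]
    by_cases h : ∀ u ∈ stabilizers E G n,
        u * (star (pauli i) * pauli j) = star (pauli i) * pauli j * u
    · left
      refine mem_stabilizerCommutant_of_unitary ?_ ?_ h
      · rw [star_mul, star_star, mul_assoc, ← mul_assoc (pauli i), pauli_mul_star_self, one_mul,
          star_pauli_mul_self]
      · rw [star_mul, star_star, mul_assoc, ← mul_assoc (pauli j), pauli_mul_star_self, one_mul,
          star_pauli_mul_self]
    · right
      push Not at h
      obtain ⟨u, hu, hne⟩ := h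
      obtain ⟨θ, hθ⟩ := hphase u hu
      refine ⟨u, hu, θ, ?_, hθ⟩
      rintro rfl
      exact hne (by rw [hθ, one_smul])

variable {E G n}

theorem IsFrustrationFree.apply_eq_one {ω : State (Observables E G n)} (hω : IsFrustrationFree ω) :
    ∀ u ∈ stabilizers E G n, ω u = 1 := by
  rintro _ ⟨s, hs, r, hr, rfl⟩
  exact hω s hs r hr

end Model

end CellularKitaev

end
universe u v w₁ w₂ w₃ w₄

open CellularKitaev

theorem theorem7p1 (E : Type u) [TopologicalSpace E] [T2Space E]
    [Topology.CWComplex (Set.univ : Set E)]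
    [Topology.CWComplex.FiniteDimensional (Set.univ : Set E)]
    [LocallyFiniteIncidence E] (G : Type v) [AddCommGroup G] [Fintype G] (n : ℕ) :
    (∀ (ω : State (Observables E G n)) (ω' : State (Logical E G n)),
      IsFrustrationFree ω → IsLogicalState ω ω' →
      ∀ (R : GNSTriple.{w₁} ω) (R' : GNSTriple.{w₂} ω'),
        (R.IsIrreducible ↔ R'.IsIrreducible) ∧
        Nonempty (R.center ≃⋆ₐ[ℂ] R'.center) ∧
        (R.IsFactor ↔ R'.IsFactor)) ∧
    (∀ (ω₁ ω₂ : State (Observables E G n)) (ω₁' ω₂' : State (Logical E G n)),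
      IsFrustrationFree ω₁ → IsFrustrationFree ω₂ →
      IsLogicalState ω₁ ω₁' → IsLogicalState ω₂ ω₂' →
      ∀ (R₁ : GNSTriple.{w₁} ω₁) (R₂ : GNSTriple.{w₂} ω₂)
        (R₁' : GNSTriple.{w₃} ω₁') (R₂' : GNSTriple.{w₄} ω₂'),
        R₁.IsFactor → R₂.IsFactor →
        (QuasiEquivalent R₁ R₂ ↔ QuasiEquivalent R₁' R₂')) := by
  exact ⟨fun _ _ hω hω' R R' =>
      (errorBasis_pauli E G n).isIrreducible_iff_and_centerEquiv R R' R.continuous_π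
        Ideal.Quotient.mk_surjective (toLogical_star E G n) hω.apply_eq_one hω',
    fun _ _ _ _ hω₁ hω₂ hω₁' hω₂' R₁ R₂ R₁' R₂' _ _ =>
      (errorBasis_pauli E G n).quasiEquivalent_iff R₁ R₂ R₁' R₂' R₁.continuous_π R₂.continuous_π
        Ideal.Quotient.mk_surjective (toLogical_star E G n) hω₁.apply_eq_one hω₂.apply_eq_one
        hω₁' hω₂'⟩
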